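/- Let $n\ge 2$, $1\le i\le n-1$ and $\ell\ge 0$ be integers. For $N\ge 2$ let $\omega_k=\epsilon_1+\dots+\epsilon_k$ ($1\le k\le N-1$) be the fundamental weights of $\mathfrak{sl}_N(\mathbb C)$ with respect to the diagonal Cartan subalgebra and the Borel subalgebra of upper triangular matrices; those of $\mathfrak{sl}_{2n}$ are written $\tilde\omega_k$. Write $E_{p,q}$ for the elementary matrices, $x^{(m)}=x^m/m!$ for divided powers in the complex enveloping algebra, and $f_\alpha=E_{q,p}$ for a positive root $\alpha=\epsilon_p-\epsilon_q$ ($1\le p<q\le n$) of $\mathfrak{sl}_n$. *The ring.* Let $\mathfrak n^{-,a}\subset\mathfrak{sl}_{2n}$ be the abelian Lie algebra of block matrices $\begin{pmatrix}0&A\\0&0\end{pmatrix}$ with $A$ strictly lower triangular; its root vectors are $E_{\phi(\alpha)}:=E_{q,n+p}$ for $\alpha=\epsilon_p-\epsilon_q$, $p<q$. Let $S_{\mathbb Z}(\mathfrak n^{-,a})$ be its divided power algebra over $\mathbb Z$, i.e. the commutative ring generated by $X_\alpha^{(m)}$ ($\alpha$ a positive root of $\mathfrak{sl}_n$, $m\ge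 0$) with the relations $X_\alpha^{(0)}=1$ and $X_\alpha^{(a)}X_\alpha^{(b)}=\binom{a+b}{a}X_\alpha^{(a+b)}$. Let $\theta$ be the automorphism of $S_{\mathbb Z}(\mathfrak n^{-,a})$ with $\theta(X_{\epsilon_p-\epsilon_q}^{(m)})=(-1)^mX_{\epsilon_{n+1-q}-\epsilon_{n+1-p}}^{(m)}$; it is induced by the Chevalley involution $A\mapsto -A^T$ of $\mathfrak{sl}_n$ followed by conjugation with the permutation matrix of the longest Weyl group element. *The Demazure module.* Let $\Psi(\sum_k a_k\omega_k)=\sum_k a_k\tilde\omega_{2k}$, so $\Psi(\ell\omega_i)=\ell\tilde\omega_{2i}$, and let $\tau\in S_{2n}$ be given by $\tau(2k)=n+k$, $\tau(2k-1)=k$ for $1\le k\le n$. Let $\tilde V$ be the irreducible $\mathfrak{sl}_{2n}(\mathbb C)$-module with highest weight $\Psi(\ell\omega_i)$, $\tilde v$ a highest weight vector, $\check\tau$ any representative of $\tau$ in the Chevalley group $SL_{2n}(\mathbb Z)$ (generated on $\tilde V$ by the $\exp(tE_{p,q})$, $p\neq q$, $t\in\mathbb Z$), and $v_\tau=\check\tau\tilde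 v$. Let $U_{\mathbb Z}(\tilde{\mathfrak b})$ be the subring of $U(\mathfrak{sl}_{2n})$ generated by all $E_{p,q}^{(m)}$ with $p<q$ and all $\binom{H_j}{m}$, $H_j=E_{j,j}-E_{j+1,j+1}$. The Demazure module is $\tilde V_{\mathbb Z}(\Psi(\ell\omega_i))_\tau=U_{\mathbb Z}(\tilde{\mathfrak b})v_\tau$; on it $X_\alpha^{(m)}$ acts as $E_{\phi(\alpha)}^{(m)}$. *The abelianized module.* Let $V$ be the irreducible $\mathfrak{sl}_n(\mathbb C)$-module with highest weight $\ell\omega_{n-i}$ and $v$ a highest weight vector. For $s\ge -1$ let $V_s\subset V$ be the $\mathbb Z$-span of all $f_{\beta_1}^{(m_1)}\cdots f_{\beta_k}^{(m_k)}v$ with $m_1+\dots+m_k\le s$, and put $V^a_{\mathbb Z}(\ell\omega_{n-i})=\bigoplus_{s\ge 0}V_s/V_{s-1}$, an $S_{\mathbb Z}(\mathfrak n^{-,a})$-module on which $X_\alpha^{(m)}$ acts by the maps $V_s/V_{s-1}\to V_{s+m}/V_{s+m-1}$ induced by $f_\alpha^{(m)}$. **Proposition.** There is an isomorphism of $S_{\mathbb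 Z}(\mathfrak n^{-,a})$-modules $$\tilde V_{\mathbb Z}(\Psi(\ell\omega_i))_\tau\;\simeq\;V^a_{\mathbb Z}(\ell\omega_{n-i}),$$ where $S_{\mathbb Z}(\mathfrak n^{-,a})$ acts on the right-hand side through $\theta$; that is, there is an isomorphism of abelian groups $\Phi$ with $\Phi(s\cdot x)=\theta(s)\cdot\Phi(x)$ for all $s\in S_{\mathbb Z}(\mathfrak n^{-,a})$ and $x$. -/

import Mathlib

open scoped Nat

noncomputable section

namespace AbelianizedDemazure

/-! ### Divided powers in an algebra of characteristic zero -/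

section DividedPowers

variable {A : Type*} [Ring A] [Algebra ℂ A]

/-- The divided power `x ^ m / m!`. -/
def divPow (x : A) (m : ℕ) : A := ((m ! : ℂ))⁻¹ • x ^ m

/-- The binomial element `h (h - 1) ⋯ (h - m + 1) / m!`. -/
def binomElt (h : A) (m : ℕ) : A := ((m ! : ℂ))⁻¹ • Polynomial.aeval h (descPochhammer ℂ m)

theorem divPow_zero (x : A) : divPow x 0 = 1 := by simp [divPow]

theorem divPow_one (x : A) : divPow x 1 = x := by simp [divPow]

theorem divPow_mul (x : A) (a b : ℕ) :
    divPow x a * divPow x b = ((a + b).choose a : ℕ) • divPow x (a + b) := by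
  have ha : (a ! : ℂ) ≠ 0 := by exact_mod_cast a.factorial_ne_zero
  have hb : (b ! : ℂ) ≠ 0 := by exact_mod_cast b.factorial_ne_zero
  have hab : ((a + b) ! : ℂ) ≠ 0 := by exact_mod_cast (a + b).factorial_ne_zero
  have h : ((a + b).choose a : ℂ) * (a ! : ℂ) * (b ! : ℂ) = ((a + b) ! : ℂ) := by
    have := Nat.choose_mul_factorial_mul_factorial (Nat.le_add_right a b)
    rw [Nat.add_sub_cancel_left] at this
    exact_mod_cast this
  have h2 : (a ! : ℂ)⁻¹ * (b ! : ℂ)⁻¹ = ((a + b).choose a : ℂ) * ((a + b) ! : ℂ)⁻¹ := by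
    rw [← h]
    have hc : ((a + b).choose a : ℂ) ≠ 0 := by
      exact_mod_cast (Nat.choose_pos (Nat.le_add_right a b)).ne'
    field_simp
  rw [← Nat.cast_smul_eq_nsmul ℂ]
  simp only [divPow]
  rw [smul_mul_smul_comm, ← pow_add, smul_smul, h2]

theorem divPow_commute {x y : A} (h : Commute x y) (a b : ℕ) :
    Commute (divPow x a) (divPow y b) :=
  ((h.pow_pow a b).smul_left _).smul_right _

theorem succ_smul_divPow (x : A) (m : ℕ) : ((m : ℂ) + 1) • divPow x (m + 1) = x * divPow x m := by
  have h := divPow_mul x 1 m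
  rw [divPow_one, Nat.choose_one_right, ← Nat.cast_smul_eq_nsmul ℂ] at h
  rw [h, add_comm 1 m]
  push_cast
  rfl

/-- `x y^{(m+1)} = y^{(m+1)} x + y^{(m)} [x, y]` if `[x, y]` is central. -/
theorem mul_divPow_succ {x y z : A} (h : x * y = y * x + z) (hy : Commute y z) (m : ℕ) :
    x * divPow y (m + 1) = divPow y (m + 1) * x + divPow y m * z := by
  have hpow : ∀ m : ℕ, x * y ^ (m + 1) = y ^ (m + 1) * x + ((m : ℂ) + 1) • (y ^ m * z) := by
    intro m
    induction m with
    | zero => simp [h]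
    | succ m ih =>
      rw [pow_succ, ← mul_assoc, ih, add_mul, mul_assoc, h, mul_add, smul_mul_assoc, mul_assoc _ z y,
        ← hy.eq, ← mul_assoc (y ^ m), ← pow_succ, ← mul_assoc, ← pow_succ]
      push_cast
      module
  have hm : ((m + 1) ! : ℂ)⁻¹ * ((m : ℂ) + 1) = (m ! : ℂ)⁻¹ := by
    have h1 : (m ! : ℂ) ≠ 0 := by exact_mod_cast m.factorial_ne_zero
    have h2 : (m : ℂ) + 1 ≠ 0 := by exact_mod_cast m.succ_ne_zero
    rw [Nat.factorial_succ]
    push_cast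
    field_simp
  simp only [divPow, mul_smul_comm, smul_mul_assoc]
  rw [hpow, smul_add, smul_smul, hm]

/-- The general term of the reordering formula for `x^{(a)} y^{(b)}`. -/
def reorderTerm (x y z : A) (a b k : ℕ) : A :=
  if k ≤ a ∧ k ≤ b then divPow y (b - k) * divPow x (a - k) * divPow z k else 0

/-- If `[x, y] = z` commutes with `x` and `y`, then
`x^{(a)} y^{(b)} = ∑ₖ y^{(b-k)} x^{(a-k)} z^{(k)}`. -/
theorem divPow_reorder {x y z : A} (h : x * y = y * x + z) (hx : Commute x z) (hy : Commute y z)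
    (a b : ℕ) :
    divPow x a * divPow y b = ∑ k ∈ Finset.range (a + 1), reorderTerm x y z a b k := by
  induction a with
  | zero => simp [reorderTerm, divPow_zero]
  | succ a ih =>
    have key : ∀ k, k ≤ a → x * reorderTerm x y z a b k =
        ((a : ℂ) + 1 - k) • reorderTerm x y z (a + 1) b k +
          ((k : ℂ) + 1) • reorderTerm x y z (a + 1) b (k + 1) := by
      intro k hk
      obtain ⟨c, rfl⟩ := Nat.exists_eq_add_of_le hk
      by_cases hb : k ≤ b
      · obtain ⟨d, rfl⟩ := Nat.exists_eq_add_of_le hb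
        have e1 : reorderTerm x y z (k + c) (k + d) k =
            divPow y d * divPow x c * divPow z k := by
          simp [reorderTerm]
        have e2 : reorderTerm x y z (k + c + 1) (k + d) k =
            divPow y d * divPow x (c + 1) * divPow z k := by
          rw [reorderTerm, if_pos ⟨by omega, by omega⟩]
          congr 3 <;> omega
        have hc : (((k + c : ℕ) : ℂ) + 1 - k) = (c : ℂ) + 1 := by push_cast; ring
        have hxc : x * divPow x c = ((c : ℂ) + 1) • divPow x (c + 1) := (succ_smul_divPow x c).symm
        rw [e1, e2, hc]
        cases d with
        | zero =>
          have e3 : reorderTerm x y z (k + c + 1) (k + 0) (k + 1) = 0 := by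
            rw [reorderTerm, if_neg (by omega)]
          rw [e3, divPow_zero, one_mul, one_mul, smul_zero, add_zero, ← mul_assoc, hxc,
            smul_mul_assoc]
        | succ d =>
          have e3 : reorderTerm x y z (k + c + 1) (k + (d + 1)) (k + 1) =
              divPow y d * divPow x c * divPow z (k + 1) := by
            rw [reorderTerm, if_pos ⟨by omega, by omega⟩]
            congr 3 <;> omega
          have hzx : z * divPow x c = divPow x c * z := by
            have := divPow_commute hx.symm 1 c
            rw [divPow_one] at this
            exact this.eq
          rw [e3, ← mul_assoc, ← mul_assoc, mul_divPow_succ h hy, add_mul, add_mul, mul_assoc _ x,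
            hxc, mul_assoc _ z, hzx, mul_smul_comm, smul_mul_assoc, ← mul_assoc (divPow y d),
            mul_assoc _ z, ← succ_smul_divPow, mul_smul_comm]
      · rw [reorderTerm, if_neg (by omega), reorderTerm, if_neg (by omega), reorderTerm,
          if_neg (by omega)]
        simp
    have hne : ((a : ℂ) + 1) ≠ 0 := by exact_mod_cast a.succ_ne_zero
    have hsum : ((a : ℂ) + 1) • (divPow x (a + 1) * divPow y b) =
        ((a : ℂ) + 1) • ∑ k ∈ Finset.range (a + 1 + 1), reorderTerm x y z (a + 1) b k := by
      rw [← smul_mul_assoc, succ_smul_divPow, mul_assoc, ih, Finset.mul_sum,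
        Finset.sum_congr rfl (fun k hk => key k (by simpa [Nat.lt_succ_iff] using hk)),
        Finset.sum_add_distrib]
      have s1 : ∑ k ∈ Finset.range (a + 1),
          ((a : ℂ) + 1 - k) • reorderTerm x y z (a + 1) b k =
          ∑ k ∈ Finset.range (a + 1 + 1),
            ((a : ℂ) + 1 - k) • reorderTerm x y z (a + 1) b k := by
        rw [Finset.sum_range_succ _ (a + 1)]
        simp
      have s2 : ∑ k ∈ Finset.range (a + 1),
          ((k : ℂ) + 1) • reorderTerm x y z (a + 1) b (k + 1) =
          ∑ k ∈ Finset.range (a + 1 + 1), (k : ℂ) • reorderTerm x y z (a + 1) b k := by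
        rw [Finset.sum_range_succ' _ (a + 1)]
        simp
      rw [s1, s2, ← Finset.sum_add_distrib, Finset.smul_sum]
      refine Finset.sum_congr rfl fun k _ => ?_
      rw [← add_smul]
      congr 1
      ring
    have := congrArg (fun t => ((a : ℂ) + 1)⁻¹ • t) hsum
    simpa [smul_smul, inv_mul_cancel₀ hne] using this

end DividedPowers

/-! ### The Lie algebra `𝔰𝔩_N`, its weights and its hyperalgebras -/

/-- The complex Lie algebra `𝔰𝔩_N`. -/
abbrev SlN (N : ℕ) := LieAlgebra.SpecialLinear.sl (Fin N) ℂ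

/-- The complex enveloping algebra `U(𝔰𝔩_N)`. -/
abbrev UN (N : ℕ) := UniversalEnvelopingAlgebra ℂ (SlN N)

/-- The elementary matrix `E_{p,q}`, `p ≠ q`: a root vector for the root `ε_p - ε_q`. -/
def elemMat {N : ℕ} (p q : Fin N) (h : p ≠ q) : SlN N :=
  LieAlgebra.SpecialLinear.single p q h (1 : ℂ)

/-- The root vector `E_{p,q}` as an element of the enveloping algebra. -/
def rootVec {N : ℕ} (p q : Fin N) (h : p ≠ q) : UN N :=
  UniversalEnvelopingAlgebra.ι ℂ (elemMat p q h)

/-- The simple coroot `H_j = E_{j,j} - E_{j+1,j+1}` in the enveloping algebra. -/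
def simpleCoroot {N : ℕ} (j : ℕ) (h : j + 1 < N) : UN N :=
  UniversalEnvelopingAlgebra.ι ℂ
    (LieAlgebra.SpecialLinear.singleSubSingle (⟨j, by omega⟩ : Fin N) ⟨j + 1, h⟩ (1 : ℂ))

/-- The hyperalgebra `U_ℤ(𝔟)` of the Borel subalgebra of upper triangular matrices: the subring of
the enveloping algebra generated by the divided powers of the positive root vectors and the
binomial elements of the simple coroots. -/
def hyperBorel (N : ℕ) : Subalgebra ℤ (UN N) :=
  Algebra.adjoin ℤ
    ({x | ∃ (p q : Fin N) (h : p < q) (m : ℕ), x = divPow (rootVec p q h.ne) m} ∪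
      {x | ∃ (j : ℕ) (h : j + 1 < N) (m : ℕ), x = binomElt (simpleCoroot j h) m})

/-- Integral weights of `𝔰𝔩_N`: `a` stands for `∑ a_k ω_k`, the sum over `0 < k < N`. -/
abbrev IntWeight (N : ℕ) := Set.Ioo 0 N → ℤ

/-- The value of the weight `∑ a_k ω_k` at the diagonal matrix with (traceless) diagonal `d`, where
`ω_k = ε_1 + ⋯ + ε_k`. -/
def weightVal {N : ℕ} (a : IntWeight N) (d : Fin N → ℂ) : ℂ :=
  ∑ k : Set.Ioo 0 N, (a k : ℂ) * ∑ t : Fin N, if (t : ℕ) < k then d t else 0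

/-- The map `Ψ(∑ a_k ω_k) = ∑ a_k ω̃_{2k}` from weights of `𝔰𝔩_n` to weights of `𝔰𝔩_{2n}`. -/
def Psi {n : ℕ} (a : IntWeight n) : IntWeight (2 * n) :=
  ∑ k : Set.Ioo 0 n,
    Pi.single ⟨2 * (k : ℕ), by have := k.2.1; omega, by have := k.2.2; omega⟩ (a k)

/-- The index `n - k` of the fundamental weight dual to `ω_k`. -/
def dualIndex {n : ℕ} (k : Set.Ioo 0 n) : Set.Ioo 0 n :=
  ⟨n - k, by have := k.2.2; omega, by have := k.2.1; have := k.2.2; omega⟩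

/-! ### Representations -/

section Representations

variable {N : ℕ} {V : Type*} [AddCommGroup V] [Module ℂ V] [LieRingModule (SlN N) V]
  [LieModule ℂ (SlN N) V]

/-- `v` is a highest weight vector of weight `μ`. -/
structure IsHighestWeightVector (μ : IntWeight N) (v : V) : Prop where
  ne_zero : v ≠ 0
  raising : ∀ (p q : Fin N) (h : p < q), ⁅elemMat p q h.ne, v⁆ = 0
  weight : ∀ (d : Fin N → ℂ) (x : SlN N), (x : Matrix (Fin N) (Fin N) ℂ) = Matrix.diagonal d →
    ⁅x, v⁆ = weightVal μ d • v

variable (V) in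
/-- The action of the enveloping algebra. -/
def uAct : UN N →ₐ[ℂ] Module.End ℂ V :=
  UniversalEnvelopingAlgebra.lift ℂ (LieModule.toEnd ℂ (SlN N) V)

/-- The map `u ↦ u v`. -/
def orbitMap (v : V) : UN N →ₗ[ℤ] V where
  toFun u := uAct V u v
  map_add' x y := by simp
  map_smul' c x := by simp

variable (N V) in
/-- The image in `GL(V)` of the simply connected Chevalley group `SL_N(ℤ)`: it is generated by the
`exp (t E_{p,q})`, `t ∈ ℤ`. -/
def chevalleyGroup : Subgroup (Module.End ℂ V)ˣ :=
  Subgroup.closure {u | ∃ (p q : Fin N) (h : p ≠ q) (t : ℤ) (k : ℕ),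
    LieModule.toEnd ℂ (SlN N) V (elemMat p q h) ^ k = 0 ∧
    (u : Module.End ℂ V) = ∑ m ∈ Finset.range k,
      ((t : ℂ) ^ m) • divPow (LieModule.toEnd ℂ (SlN N) V (elemMat p q h)) m}

/-- `g` is the operator on `V` of a representative, in the Chevalley group, of the Weyl group element
`w`: it lies in the Chevalley group and conjugates the Cartan subalgebra into itself by `w`. -/
structure IsWeylRepresentative (w : Equiv.Perm (Fin N)) (g : (Module.End ℂ V)ˣ) : Prop where
  mem : g ∈ chevalleyGroup N V
  conj : ∀ (d : Fin N → ℂ) (x y : SlN N),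
    (x : Matrix (Fin N) (Fin N) ℂ) = Matrix.diagonal d →
    (y : Matrix (Fin N) (Fin N) ℂ) = Matrix.diagonal (fun t => d (w.symm t)) →
    (g : Module.End ℂ V) * LieModule.toEnd ℂ (SlN N) V x =
      LieModule.toEnd ℂ (SlN N) V y * (g : Module.End ℂ V)

variable (N) in
/-- The Demazure module `U_ℤ(𝔟) v_w`, where `v_w = g v` for a highest weight vector `v` and a
representative `g` of the Weyl group element `w`. -/
def demazure (g : (Module.End ℂ V)ˣ) (v : V) : Submodule ℤ V :=
  (Subalgebra.toSubmodule (hyperBorel N)).map (orbitMap (N := N) ((g : Module.End ℂ V) v))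

theorem orbitMap_mul (u u' : UN N) (v : V) : orbitMap v (u * u') = uAct V u (orbitMap v u') := by
  simp [orbitMap]

theorem demazure_stable (g : (Module.End ℂ V)ˣ) (v : V) {u : UN N} (hu : u ∈ hyperBorel N)
    {x : V} (hx : x ∈ demazure N g v) : uAct V u x ∈ demazure N g v := by
  obtain ⟨u', hu', rfl⟩ := hx
  exact ⟨u * u', (hyperBorel N).mul_mem hu hu', orbitMap_mul u u' _⟩

end Representations

/-- The Weyl group element `τ ∈ S_{2n}`: in one-based numbering `τ(2k) = n + k` and
`τ(2k - 1) = k` for `k = 1, …, n`. -/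
def tau (n : ℕ) : Equiv.Perm (Fin (2 * n)) where
  toFun t := if (t : ℕ) % 2 = 0 then ⟨t / 2, by omega⟩ else ⟨n + t / 2, by omega⟩
  invFun t := if h : (t : ℕ) < n then ⟨2 * t, by omega⟩ else ⟨2 * (t - n) + 1, by omega⟩
  left_inv t := by grind
  right_inv t := by grind

/-! ### The ring `S_ℤ(𝔫^{-,a})` -/

/-- The positive roots `ε_i - ε_j`, `i < j`, of `𝔰𝔩_n`. -/
abbrev PosRoot (n : ℕ) := {r : Fin n × Fin n // r.1 < r.2}

/-- The relations between the divided powers `X_α^{(m)}` of commuting variables. -/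
inductive SymRel (n : ℕ) :
    FreeAlgebra ℤ (PosRoot n × ℕ) → FreeAlgebra ℤ (PosRoot n × ℕ) → Prop
  | zero (α : PosRoot n) : SymRel n (FreeAlgebra.ι ℤ (α, 0)) 1
  | mul (α : PosRoot n) (a b : ℕ) :
      SymRel n (FreeAlgebra.ι ℤ (α, a) * FreeAlgebra.ι ℤ (α, b))
        ((a + b).choose a • FreeAlgebra.ι ℤ (α, a + b))
  | comm (α β : PosRoot n) (a b : ℕ) :
      SymRel n (FreeAlgebra.ι ℤ (α, a) * FreeAlgebra.ι ℤ (β, b))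
        (FreeAlgebra.ι ℤ (β, b) * FreeAlgebra.ι ℤ (α, a))

/-- The ring `S_ℤ(𝔫^{-,a})`: the commutative divided power algebra over `ℤ` on the abelian Lie
algebra with basis the root vectors `X_α`, `α` a positive root. It is the hyperalgebra of `𝔫^{-,a}`
(where `X_α` is `E_{φ(α)}`) and the associated graded ring of `U_ℤ(𝔫^-)` (where `X_α` is the class
of `f_α`). -/
def SymZ (n : ℕ) : Type := RingQuot (SymRel n)

instance (n : ℕ) : Ring (SymZ n) := inferInstanceAs (Ring (RingQuot (SymRel n)))

/-- The divided power `X_α^{(m)}` in `S_ℤ(𝔫^{-,a})`. -/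
def SymZ.gen {n : ℕ} (α : PosRoot n) (m : ℕ) : SymZ n :=
  RingQuot.mkRingHom (SymRel n) (FreeAlgebra.ι ℤ (α, m))

theorem SymZ.gen_zero {n : ℕ} (α : PosRoot n) : SymZ.gen α 0 = 1 :=
  (RingQuot.mkRingHom_rel (SymRel.zero α)).trans (map_one _)

theorem SymZ.gen_mul {n : ℕ} (α : PosRoot n) (a b : ℕ) :
    SymZ.gen α a * SymZ.gen α b = (a + b).choose a • SymZ.gen α (a + b) := by
  have h := RingQuot.mkRingHom_rel (SymRel.mul α a b)
  rw [map_mul, map_nsmul] at h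
  exact h

theorem SymZ.gen_comm {n : ℕ} (α β : PosRoot n) (a b : ℕ) :
    SymZ.gen α a * SymZ.gen β b = SymZ.gen β b * SymZ.gen α a := by
  have h := RingQuot.mkRingHom_rel (SymRel.comm α β a b)
  rw [map_mul, map_mul] at h
  exact h

/-- Elements of a ring that satisfy the relations of the `X_α^{(m)}` define a ring homomorphism. -/
def SymZ.lift {n : ℕ} {B : Type*} [Ring B] (P : PosRoot n → ℕ → B) (h0 : ∀ α, P α 0 = 1)
    (hmul : ∀ α a b, P α a * P α b = (a + b).choose a • P α (a + b))
    (hcomm : ∀ α β a b, P α a * P β b = P β b * P α a) : SymZ n →+* B :=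
  RingQuot.lift ⟨((FreeAlgebra.lift ℤ fun x : PosRoot n × ℕ => P x.1 x.2 :
      FreeAlgebra ℤ (PosRoot n × ℕ) →ₐ[ℤ] B) : FreeAlgebra ℤ (PosRoot n × ℕ) →+* B), by
    intro x y h
    cases h with
    | zero α => simp [h0]
    | mul α a b => simp [hmul]
    | comm α β a b => simp [hcomm α β a b]⟩

theorem SymZ.lift_gen {n : ℕ} {B : Type*} [Ring B] (P : PosRoot n → ℕ → B) (h0 : ∀ α, P α 0 = 1)
    (hmul : ∀ α a b, P α a * P α b = (a + b).choose a • P α (a + b))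
    (hcomm : ∀ α β a b, P α a * P β b = P β b * P α a) (α : PosRoot n) (m : ℕ) :
    SymZ.lift P h0 hmul hcomm (SymZ.gen α m) = P α m := by
  unfold SymZ.lift SymZ.gen
  erw [RingQuot.lift_mkRingHom_apply]
  simp

theorem SymZ.hom_ext {n : ℕ} {B : Type*} [Ring B] {f g : SymZ n →+* B}
    (h : ∀ α m, f (SymZ.gen α m) = g (SymZ.gen α m)) : f = g := by
  refine RingQuot.ringQuot_ext (r := SymRel n) f g ?_
  have : ((f.comp (RingQuot.mkRingHom (SymRel n))).toIntAlgHom :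
      FreeAlgebra ℤ (PosRoot n × ℕ) →ₐ[ℤ] B) =
      (g.comp (RingQuot.mkRingHom (SymRel n))).toIntAlgHom := by
    apply FreeAlgebra.hom_ext
    funext x
    exact h x.1 x.2
  ext x
  exact DFunLike.congr_fun this x

/-- The permutation `ε_i - ε_j ↦ ε_{n+1-j} - ε_{n+1-i}` of the positive roots (one-based
numbering): the automorphism `-w₀`. -/
def dualRoot {n : ℕ} (α : PosRoot n) : PosRoot n :=
  ⟨(Fin.rev α.1.2, Fin.rev α.1.1), Fin.rev_lt_rev.2 α.2⟩

/-- The automorphism of `S_ℤ(𝔫^{-,a})` induced by the automorphism `A ↦ -w₀ Aᵀ w₀⁻¹` of `𝔫^-`, the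
Chevalley involution `A ↦ -Aᵀ` followed by conjugation with the permutation matrix of the longest
element `w₀`. It sends `X_α^{(m)}` to `(-X_{-w₀ α})^{(m)}`. -/
def chevalleyTwist (n : ℕ) : SymZ n →+* SymZ n :=
  SymZ.lift (fun α m => (-1) ^ m * SymZ.gen (dualRoot α) m)
    (fun α => by simp [SymZ.gen_zero])
    (fun α a b => by
      rw [((Commute.neg_one_right (SymZ.gen (dualRoot α) a)).pow_right b).mul_mul_mul_comm, ← pow_add,
        SymZ.gen_mul, mul_smul_comm])
    (fun α β a b => by
      rw [((Commute.neg_one_right (SymZ.gen (dualRoot α) a)).pow_right b).mul_mul_mul_comm,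
        ((Commute.neg_one_right (SymZ.gen (dualRoot β) b)).pow_right a).mul_mul_mul_comm,
        SymZ.gen_comm, ← pow_add, ← pow_add, add_comm])

theorem chevalleyTwist_gen {n : ℕ} (α : PosRoot n) (m : ℕ) :
    chevalleyTwist n (SymZ.gen α m) = (-1) ^ m * SymZ.gen (dualRoot α) m :=
  SymZ.lift_gen _ _ _ _ α m

theorem chevalleyTwist_comp (n : ℕ) :
    (chevalleyTwist n).comp (chevalleyTwist n) = RingHom.id (SymZ n) := by
  refine SymZ.hom_ext fun α m => ?_
  have h : dualRoot (dualRoot α) = α := by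
    apply Subtype.ext
    simp [dualRoot]
  rw [RingHom.comp_apply, chevalleyTwist_gen, map_mul, chevalleyTwist_gen, h, map_pow, map_neg,
    map_one, ← mul_assoc, ← pow_add, Even.neg_one_pow ⟨m, rfl⟩, one_mul, RingHom.id_apply]

instance (n : ℕ) : RingHomInvPair (chevalleyTwist n) (chevalleyTwist n) where
  comp_eq := chevalleyTwist_comp n
  comp_eq₂ := chevalleyTwist_comp n

/-! ### The Demazure module as an `S_ℤ(𝔫^{-,a})`-module -/

/-- The root vector `E_{φ(α)} ∈ 𝔫^{-,a} ⊆ 𝔰𝔩_{2n}`: for `α = ε_i - ε_j` it is `E_{j, n+i}`, the image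
of the lower triangular matrix `f_α = E_{j,i}` in the upper right block. -/
def abelVec {n : ℕ} (α : PosRoot n) : UN (2 * n) :=
  rootVec ⟨α.1.2, by omega⟩ ⟨n + α.1.1, by omega⟩ (by simp [Fin.ext_iff]; omega)

theorem lie_elemMat {N : ℕ} {p q r s : Fin N} (h : p ≠ q) (h' : r ≠ s) (h1 : q ≠ r) (h2 : s ≠ p) :
    ⁅elemMat p q h, elemMat r s h'⁆ = 0 := by
  apply Subtype.ext
  rw [LieAlgebra.SpecialLinear.sl_bracket]
  simp [elemMat, h1, h2]

theorem lie_elemMat' {N : ℕ} {p q s : Fin N} (h : p ≠ q) (h' : q ≠ s) (h2 : p ≠ s) :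
    ⁅elemMat p q h, elemMat q s h'⁆ = elemMat p s h2 := by
  apply Subtype.ext
  rw [LieAlgebra.SpecialLinear.sl_bracket]
  simp [elemMat, h2.symm]

attribute [local instance 100] LieRing.ofAssociativeRing

theorem rootVec_commute {N : ℕ} {p q r s : Fin N} (h : p ≠ q) (h' : r ≠ s) (h1 : q ≠ r)
    (h2 : s ≠ p) : Commute (rootVec p q h) (rootVec r s h') := by
  rw [commute_iff_lie_eq, rootVec, rootVec, ← LieHom.map_lie, lie_elemMat h h' h1 h2, map_zero]

theorem rootVec_mul {N : ℕ} {p q s : Fin N} (h : p ≠ q) (h' : q ≠ s) (h2 : p ≠ s) :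
    rootVec p q h * rootVec q s h' = rootVec q s h' * rootVec p q h + rootVec p s h2 := by
  rw [← sub_eq_iff_eq_add', ← LieRing.of_associative_ring_bracket, rootVec, rootVec,
    ← LieHom.map_lie, lie_elemMat' h h' h2, rootVec]

theorem abelVec_commute {n : ℕ} (α β : PosRoot n) : Commute (abelVec α) (abelVec β) := by
  apply rootVec_commute
  · simp [Fin.ext_iff]; omega
  · simp [Fin.ext_iff]; omega

theorem abelVec_mem {n : ℕ} (α : PosRoot n) (m : ℕ) : divPow (abelVec α) m ∈ hyperBorel (2 * n) :=
  Algebra.subset_adjoin (Or.inl ⟨_, _, by simp [Fin.lt_def]; omega, m, rfl⟩)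

section DemazureModule

variable {n : ℕ} {V : Type*} [AddCommGroup V] [Module ℂ V] [LieRingModule (SlN (2 * n)) V]
  [LieModule ℂ (SlN (2 * n)) V]

/-- The operator of `E_{φ(α)}^{(m)}` on a Demazure module. -/
def demazureOp (g : (Module.End ℂ V)ˣ) (v : V) (α : PosRoot n) (m : ℕ) :
    Module.End ℤ (demazure (2 * n) g v) where
  toFun x := ⟨uAct V (divPow (abelVec α) m) x, demazure_stable g v (abelVec_mem α m) x.2⟩
  map_add' x y := by ext; simp
  map_smul' c x := by ext; simp

/-- The ring homomorphism `S_ℤ(𝔫^{-,a}) → End` with `X_α^{(m)} ↦ E_{φ(α)}^{(m)}`. -/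
def demazureAct (g : (Module.End ℂ V)ˣ) (v : V) :
    SymZ n →+* Module.End ℤ (demazure (2 * n) g v) :=
  SymZ.lift (demazureOp g v)
    (fun α => by ext x; simp [demazureOp, divPow_zero])
    (fun α a b => by
      ext x
      have := congrArg (fun u => uAct V u (x : V)) (divPow_mul (abelVec α) a b)
      simpa [demazureOp] using this)
    (fun α β a b => by
      ext x
      have := congrArg (fun u => uAct V u (x : V)) (divPow_commute (abelVec_commute α β) a b).eq
      simpa [demazureOp] using this)

instance (g : (Module.End ℂ V)ˣ) (v : V) : Module (SymZ n) (demazure (2 * n) g v) :=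
  Module.compHom _ (demazureAct g v)

theorem gen_smul_demazure (g : (Module.End ℂ V)ˣ) (v : V) (α : PosRoot n) (m : ℕ)
    (x : demazure (2 * n) g v) :
    ((SymZ.gen α m • x : demazure (2 * n) g v) : V) = uAct V (divPow (abelVec α) m) x := by
  change ((demazureAct g v (SymZ.gen α m) x : demazure (2 * n) g v) : V) = _
  rw [demazureAct, SymZ.lift_gen]
  rfl

end DemazureModule

/-! ### The PBW filtration and the abelianized module -/

/-- The root vector `f_α = E_{j,i} ∈ 𝔫^-` for `α = ε_i - ε_j`. -/
def lowVec {n : ℕ} (α : PosRoot n) : UN n := rootVec α.1.2 α.1.1 α.2.ne'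

/-- The product `f_{β₁}^{(m₁)} ⋯ f_{βₖ}^{(mₖ)}`. -/
def lowWord {n : ℕ} (l : List (PosRoot n × ℕ)) : UN n :=
  (l.map fun r => divPow (lowVec r.1) r.2).prod

/-- The total degree `m₁ + ⋯ + mₖ`. -/
def wordDeg {n : ℕ} (l : List (PosRoot n × ℕ)) : ℕ := (l.map Prod.snd).sum

/-- The PBW filtration of the hyperalgebra `U_ℤ(𝔫^-)`: the `ℤ`-span of the products of divided
powers of total degree at most `d` (zero for `d < 0`). -/
def pbw (n : ℕ) (d : ℤ) : Submodule ℤ (UN n) :=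
  Submodule.span ℤ {x | ∃ l : List (PosRoot n × ℕ), (wordDeg l : ℤ) ≤ d ∧ x = lowWord l}

theorem pbw_mono {n : ℕ} {d e : ℤ} (h : d ≤ e) : pbw n d ≤ pbw n e :=
  Submodule.span_mono fun _ ⟨l, hl, hx⟩ => ⟨l, hl.trans h, hx⟩

theorem pbw_mul {n : ℕ} {d e : ℤ} {x y : UN n} (hx : x ∈ pbw n d) (hy : y ∈ pbw n e) :
    x * y ∈ pbw n (d + e) := by
  have h : pbw n d * pbw n e ≤ pbw n (d + e) := by
    rw [pbw, pbw, Submodule.span_mul_span]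
    apply Submodule.span_le.2
    rintro _ ⟨_, ⟨l, hl, rfl⟩, _, ⟨l', hl', rfl⟩, rfl⟩
    refine Submodule.subset_span ⟨l ++ l', ?_, by simp [lowWord]⟩
    simp only [wordDeg, List.map_append, List.sum_append, Nat.cast_add] at *
    exact add_le_add hl hl'
  exact h (Submodule.mul_mem_mul hx hy)

theorem divPow_mem_pbw {n : ℕ} (α : PosRoot n) (m : ℕ) : divPow (lowVec α) m ∈ pbw n m :=
  Submodule.subset_span ⟨[(α, m)], by simp [wordDeg], by simp [lowWord]⟩

/-- Reordering when `[f_α, f_β]` is the root vector `f_γ`. -/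
theorem comm_mem_pbw_aux {n : ℕ} {α β γ : PosRoot n}
    (h : lowVec α * lowVec β = lowVec β * lowVec α + lowVec γ)
    (h1 : Commute (lowVec α) (lowVec γ)) (h2 : Commute (lowVec β) (lowVec γ)) (a b : ℕ) :
    divPow (lowVec α) a * divPow (lowVec β) b - divPow (lowVec β) b * divPow (lowVec α) a ∈
      pbw n ((a : ℤ) + b - 1) := by
  rw [divPow_reorder h h1 h2, Finset.sum_range_succ']
  have h0 : reorderTerm (lowVec α) (lowVec β) (lowVec γ) a b 0 =
      divPow (lowVec β) b * divPow (lowVec α) a := by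
    simp [reorderTerm, divPow_zero]
  rw [h0, add_sub_cancel_right]
  refine Submodule.sum_mem _ fun k _ => ?_
  rw [reorderTerm]
  split_ifs with hk
  · refine pbw_mono ?_ (pbw_mul (pbw_mul (divPow_mem_pbw β (b - (k + 1)))
      (divPow_mem_pbw α (a - (k + 1)))) (divPow_mem_pbw γ (k + 1)))
    omega
  · exact Submodule.zero_mem _

/-- Divided powers of root vectors commute up to terms of lower PBW degree. -/
theorem comm_mem_pbw {n : ℕ} (α β : PosRoot n) (a b : ℕ) :
    divPow (lowVec α) a * divPow (lowVec β) b - divPow (lowVec β) b * divPow (lowVec α) a ∈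
      pbw n ((a : ℤ) + b - 1) := by
  obtain ⟨⟨i, j⟩, hij⟩ := α
  obtain ⟨⟨k, l⟩, hkl⟩ := β
  simp only at hij hkl
  by_cases h1 : i = l
  · subst h1
    refine comm_mem_pbw_aux (γ := ⟨(k, j), hkl.trans hij⟩) ?_ ?_ ?_ a b
    · exact rootVec_mul hij.ne' hkl.ne' (hkl.trans hij).ne'
    · exact rootVec_commute _ _ hij.ne (hkl.trans hij).ne
    · exact rootVec_commute _ _ (hkl.trans hij).ne hkl.ne
  · by_cases h2 : k = j
    · subst h2
      have := comm_mem_pbw_aux (α := ⟨(k, l), hkl⟩) (β := ⟨(i, k), hij⟩)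
        (γ := ⟨(i, l), hij.trans hkl⟩) (rootVec_mul hkl.ne' hij.ne' (hij.trans hkl).ne')
        (rootVec_commute _ _ hkl.ne (hij.trans hkl).ne)
        (rootVec_commute _ _ (hij.trans hkl).ne hij.ne) b a
      have h3 := Submodule.neg_mem _ this
      rw [neg_sub, add_comm (b : ℤ)] at h3
      exact h3
    · have h3 : Commute (lowVec ⟨(i, j), hij⟩) (lowVec ⟨(k, l), hkl⟩) :=
        rootVec_commute _ _ h1 h2
      rw [(divPow_commute h3 a b).eq, sub_self]
      exact Submodule.zero_mem _

section Abelianized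

variable {n : ℕ} {V : Type*} [AddCommGroup V] [Module ℂ V] [LieRingModule (SlN n) V]
  [LieModule ℂ (SlN n) V]

variable (n) in
/-- The induced PBW filtration `U_ℤ(𝔫^-)_d v` of the `ℤ`-form `V_ℤ = U_ℤ(𝔰𝔩_n) v = U_ℤ(𝔫^-) v`
generated by a highest weight vector `v`. -/
def pbwFilt (v : V) (d : ℤ) : Submodule ℤ V := (pbw n d).map (orbitMap (N := n) v)

variable (n) in
/-- The homogeneous component `V_s / V_{s-1}` of the associated graded module. -/
abbrev grPiece (v : V) (s : ℕ) :=
  pbwFilt n v s ⧸ (pbwFilt n v ((s : ℤ) - 1)).submoduleOf (pbwFilt n v s)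

variable (n) in
/-- The abelianized module `V^a_ℤ`: the associated graded group of the PBW filtration. -/
def Abelianized (v : V) : Type _ := DirectSum ℕ (grPiece n v)

instance (v : V) : AddCommGroup (Abelianized n v) :=
  inferInstanceAs (AddCommGroup (DirectSum ℕ (grPiece n v)))

theorem act_mem_pbwFilt {v x : V} {u : UN n} {d e : ℤ} (hu : u ∈ pbw n d)
    (hx : x ∈ pbwFilt n v e) : uAct V u x ∈ pbwFilt n v (d + e) := by
  obtain ⟨u', hu', rfl⟩ := hx
  exact ⟨u * u', pbw_mul hu hu', orbitMap_mul u u' v⟩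

theorem pbwFilt_mono {v : V} {d e : ℤ} (h : d ≤ e) : pbwFilt n v d ≤ pbwFilt n v e :=
  Submodule.map_mono (pbw_mono h)

theorem low_mem (v : V) (α : PosRoot n) (m s : ℕ) {x : V} (hx : x ∈ pbwFilt n v s) :
    uAct V (divPow (lowVec α) m) x ∈ pbwFilt n v ((s + m : ℕ) : ℤ) :=
  pbwFilt_mono (by push_cast; omega) (act_mem_pbwFilt (divPow_mem_pbw α m) hx)

theorem low_mem' (v : V) (α : PosRoot n) (m s : ℕ) {x : V}
    (hx : x ∈ pbwFilt n v ((s : ℤ) - 1)) :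
    uAct V (divPow (lowVec α) m) x ∈ pbwFilt n v (((s + m : ℕ) : ℤ) - 1) :=
  pbwFilt_mono (by push_cast; omega) (act_mem_pbwFilt (divPow_mem_pbw α m) hx)

/-- The map `V_s → V_{s+m}` given by `f_α^{(m)}`. -/
def lowMap (v : V) (α : PosRoot n) (m s : ℕ) :
    pbwFilt n v s →ₗ[ℤ] pbwFilt n v ((s + m : ℕ) : ℤ) where
  toFun x := ⟨uAct V (divPow (lowVec α) m) x, low_mem v α m s x.2⟩
  map_add' x y := by ext; simp
  map_smul' c x := by ext; simp

/-- The map `V_s / V_{s-1} → V_{s+m} / V_{s+m-1}` induced by `f_α^{(m)}`. -/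
def grMap (v : V) (α : PosRoot n) (m s : ℕ) : grPiece n v s →ₗ[ℤ] grPiece n v (s + m) :=
  Submodule.mapQ _ _ (lowMap v α m s) (fun _ hx => low_mem' v α m s hx)

/-- The operator of `X_α^{(m)}` on the abelianized module, induced by `f_α^{(m)}`. -/
def abelOp (v : V) (α : PosRoot n) (m : ℕ) : Module.End ℤ (Abelianized n v) :=
  DirectSum.toModule ℤ ℕ (DirectSum ℕ (grPiece n v))
    (fun s => (DirectSum.lof ℤ ℕ (grPiece n v) (s + m)).comp (grMap v α m s))

/-- The class of `x ∈ V_s` in degree `s` of the associated graded module. -/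
def grClass (v : V) (s : ℕ) (x : V) (hx : x ∈ pbwFilt n v s) : Abelianized n v :=
  DirectSum.lof ℤ ℕ (grPiece n v) s (Submodule.Quotient.mk ⟨x, hx⟩)

theorem abelOp_grClass (v : V) (α : PosRoot n) (m s : ℕ) (x : V) (hx : x ∈ pbwFilt n v s) :
    abelOp v α m (grClass v s x hx) =
      grClass v (s + m) (uAct V (divPow (lowVec α) m) x) (low_mem v α m s hx) := by
  unfold abelOp grClass
  erw [DirectSum.toModule_lof]
  rfl

theorem grClass_congr {v : V} {s t : ℕ} (h : s = t) {x y : V} (hx : x ∈ pbwFilt n v s)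
    (hy : y ∈ pbwFilt n v t) (hxy : x - y ∈ pbwFilt n v ((t : ℤ) - 1)) :
    grClass v s x hx = grClass v t y hy := by
  subst h
  unfold grClass
  congr 1
  exact (Submodule.Quotient.eq _).2 hxy

theorem end_ext {v : V} {f g : Module.End ℤ (Abelianized n v)}
    (h : ∀ s x hx, f (grClass v s x hx) = g (grClass v s x hx)) : f = g := by
  refine DirectSum.linearMap_ext (R := ℤ) fun s => ?_
  refine Submodule.linearMap_qext _ ?_
  ext x
  exact h s x x.2

theorem nsmul_grClass {v : V} (c s : ℕ) (x : V) (hx : x ∈ pbwFilt n v s) :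
    c • grClass v s x hx = grClass v s (c • x) (nsmul_mem hx c) := by
  exact (map_nsmul (DirectSum.lof ℤ ℕ (grPiece n v) s) c (Submodule.Quotient.mk ⟨x, hx⟩)).symm

/-- The ring homomorphism `S_ℤ(𝔫^{-,a}) → End` where `X_α^{(m)}` acts by the class of `f_α^{(m)}`. -/
def abelAct (v : V) : SymZ n →+* Module.End ℤ (Abelianized n v) :=
  SymZ.lift (abelOp v)
    (fun α => end_ext fun s x hx => by
      rw [abelOp_grClass]
      refine grClass_congr (by simp) _ _ ?_
      simp [divPow_zero])
    (fun α a b => end_ext fun s x hx => by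
      rw [Module.End.mul_apply, abelOp_grClass, abelOp_grClass, LinearMap.smul_apply,
        abelOp_grClass, nsmul_grClass]
      refine grClass_congr (by omega) _ _ ?_
      have := congrArg (fun u => uAct V u x) (divPow_mul (lowVec α) a b)
      simp only [map_mul, map_nsmul, Module.End.mul_apply, LinearMap.smul_apply] at this
      rw [this, sub_self]
      exact Submodule.zero_mem _)
    (fun α β a b => end_ext fun s x hx => by
      rw [Module.End.mul_apply, Module.End.mul_apply, abelOp_grClass, abelOp_grClass,
        abelOp_grClass, abelOp_grClass]
      refine grClass_congr (by omega) _ _ ?_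
      have := act_mem_pbwFilt (comm_mem_pbw α β a b) hx
      simp only [map_sub, map_mul, Module.End.mul_apply, LinearMap.sub_apply] at this
      exact pbwFilt_mono (by push_cast; omega) this)

instance (v : V) : Module (SymZ n) (Abelianized n v) := Module.compHom _ (abelAct v)

theorem gen_smul_grClass (v : V) (α : PosRoot n) (m s : ℕ) (x : V) (hx : x ∈ pbwFilt n v s) :
    SymZ.gen α m • grClass v s x hx =
      grClass v (s + m) (uAct V (divPow (lowVec α) m) x) (low_mem v α m s hx) := by
  rw [← abelOp_grClass]
  change abelAct v (SymZ.gen α m) _ = _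
  rw [abelAct, SymZ.lift_gen]

end Abelianized

end AbelianizedDemazure

end

open AbelianizedDemazure

/-! For a set `S` of indices call `E_{t,s}` with `s ∈ S`, `t ∉ S` lowering, `E_{s,t}` raising, and
the remaining matrix units Levi. The lowering operators commute with one another. Both modules turn
out to be direct sums of lattices `L_d`, where `L_d` is the `ℤ`-span of the degree `d` divided power
monomials in the lowering operators of a `𝔤𝔩_n`, applied to an extremal vector of weight `ℓ ∑_{s ∈
S} ε_s` (`lattice`).

Demazure side. The weight of `v_τ` is supported, in one-based numbering, on `{1, …, i} ∪ {n+1, …,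
n+i}`. Off-diagonal units with a row among the first `i` positions or a column among the last `n -
i` annihilate everything in sight. Only the `n` positions `i+1, …, n+i` matter. Reindexed by
`blockIndex`, they give a `𝔤𝔩_n` with `S = {1, …, i}` in which each upper triangular root vector is
lowering or Levi. Levi divided powers preserve every `L_d` and the binomial elements act on
monomials by integers, so the Demazure module is `∑ L_d` (`demazure_eq_iSup_lattice`). The sum is
direct because `∑_{s ∈ S} E_{s,s}` has different eigenvalues on different `L_d`.

Abelianized side. Twisting by `A ↦ -w₀ Aᵀ w₀⁻¹` turns `v` into an extremal vector of weight `ℓ ω_i`.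
Every `f_α` is again lowering or Levi, hence `V_s` is the sum of the `L_d` with `d ≤ s` and `V_s /
V_{s-1} ≃ L_s` (`pbwFilt_eq_latticeLE`). The twist produces exactly the signs and the root
permutation of `θ`.

Comparison. The two families of lattices are matched through the lattices generated by `(x, v)` in
`W × V` under the diagonal action, with `x = v_τ`. They project onto both sides. A kernel element of
positive degree has, by induction on the degree, all its images under raising operators equal to
zero, so its other component is annihilated by all raising operators. Such a component vanishes by
nondegeneracy (`IsExtremal.isNondegenerate`), which follows from simplicity: a nonzero vector of
this kind in positive degree would generate a submodule not containing the extremal vector. Neither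
the classification of simple modules nor complete reducibility is needed. -/

noncomputable section

namespace AbelianizedDemazure

/-! ### Representations of `𝔤𝔩_I` given by matrix units -/

section MatrixUnits

set_option linter.unusedSectionVars false

variable {I X Y : Type*} [DecidableEq I] [AddCommGroup X] [Module ℂ X] [AddCommGroup Y] [Module ℂ Y]

/-- The operators `A a b` satisfy the commutation relations of the matrix units `E_{a,b}`. -/
def IsGlRep (A : I → I → Module.End ℂ X) : Prop :=
  ∀ a b c d, A a b * A c d =
    A c d * A a b + (if b = c then A a d else 0) - (if d = a then A c b else 0)

/-- `x` is a weight vector of weight `ℓ ∑_{a ∈ S} ε_a` annihilated by all matrix units outside the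
diagonal, except possibly the `E_{t,s}` with `s ∈ S`, `t ∉ S`. -/
structure IsExtremal (A : I → I → Module.End ℂ X) (S : Finset I) (ℓ : ℂ) (x : X) : Prop where
  ne_zero : x ≠ 0
  kill : ∀ a b, a ≠ b → (b ∈ S → a ∈ S) → A a b x = 0
  diag_mem : ∀ a ∈ S, A a a x = ℓ • x
  diag_notMem : ∀ a, a ∉ S → A a a x = 0

/-- There are no proper nonzero subspaces stable under all `A a b`. -/
def IsSimpleFamily (A : I → I → Module.End ℂ X) : Prop :=
  ∀ U : Submodule ℂ X, (∀ a b, ∀ z ∈ U, A a b z ∈ U) → U = ⊥ ∨ U = ⊤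

theorem IsGlRep.apply {A : I → I → Module.End ℂ X} (hA : IsGlRep A) (a b c d : I) (z : X) :
    A a b (A c d z) =
      A c d (A a b z) + (if b = c then A a d z else 0) - (if d = a then A c b z else 0) := by
  have := DFunLike.congr_fun (hA a b c d) z
  simp only [Module.End.mul_apply, LinearMap.sub_apply, LinearMap.add_apply] at this
  rw [this]
  split_ifs <;> rfl

/-- The space spanned by the products of `d` operators `A t s`, `s ∈ S`, `t ∉ S`, applied to `N`. -/
def level (A : I → I → Module.End ℂ X) (S : Finset I) (N : Submodule ℂ X) : ℕ → Submodule ℂ X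
  | 0 => N
  | d + 1 => Submodule.span ℂ {y | ∃ s ∈ S, ∃ t, t ∉ S ∧ ∃ z ∈ level A S N d, y = A t s z}

variable {A : I → I → Module.End ℂ X} {B : I → I → Module.End ℂ Y} {S : Finset I}
  {N : Submodule ℂ X}

theorem lower_mem_level {s t : I} (hs : s ∈ S) (ht : t ∉ S) {d : ℕ} {z : X}
    (hz : z ∈ level A S N d) : A t s z ∈ level A S N (d + 1) :=
  Submodule.subset_span ⟨s, hs, t, ht, z, hz, rfl⟩

theorem level_succ_induction {d : ℕ} {P : Submodule ℂ X}
    (h : ∀ s ∈ S, ∀ t, t ∉ S → ∀ z ∈ level A S N d, A t s z ∈ P) : level A S N (d + 1) ≤ P := by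
  refine Submodule.span_le.2 ?_
  rintro _ ⟨s, hs, t, ht, z, hz, rfl⟩
  exact h s hs t ht z hz

/-- The commutator of a Levi unit with a lowering operator is zero or, up to sign, another lowering
operator, so moving the Levi unit past it does not change the level. -/
theorem levi_mem_level (hA : IsGlRep A)
    (hN : ∀ a b, (a ∈ S ↔ b ∈ S) → ∀ z ∈ N, A a b z ∈ N) (d : ℕ) :
    ∀ a b, (a ∈ S ↔ b ∈ S) → ∀ z ∈ level A S N d, A a b z ∈ level A S N d := by
  induction d with
  | zero => exact hN
  | succ d ih =>
    intro a b hab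
    refine level_succ_induction (P := (level A S N (d + 1)).comap (A a b)) fun s hs t ht z hz => ?_
    rw [Submodule.mem_comap, hA.apply]
    refine sub_mem (add_mem (lower_mem_level hs ht (ih a b hab z hz)) ?_) ?_
    · split_ifs with h
      · exact lower_mem_level hs (by rw [hab, h]; exact ht) hz
      · exact zero_mem _
    · split_ifs with h
      · exact lower_mem_level (by rw [← hab, ← h]; exact hs) ht hz
      · exact zero_mem _

/-- A raising operator maps each level to the previous one. -/
theorem raise_mem_level (hA : IsGlRep A)
    (hN : ∀ a b, (a ∈ S ↔ b ∈ S) → ∀ z ∈ N, A a b z ∈ N)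
    (hN' : ∀ s ∈ S, ∀ t, t ∉ S → ∀ z ∈ N, A s t z = 0) (d : ℕ) :
    ∀ s ∈ S, ∀ t, t ∉ S → ∀ z ∈ level A S N (d + 1), A s t z ∈ level A S N d := by
  induction d with
  | zero =>
    intro s hs t ht
    refine level_succ_induction (P := N.comap (A s t)) fun s' hs' t' ht' z hz => ?_
    rw [Submodule.mem_comap, hA.apply, hN' s hs t ht z hz, map_zero, zero_add]
    refine sub_mem ?_ ?_
    · split_ifs
      · exact hN _ _ (by simp [hs, hs']) z hz
      · exact zero_mem _
    · split_ifs
      · exact hN _ _ (by simp [ht, ht']) z hz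
      · exact zero_mem _
  | succ d ih =>
    intro s hs t ht
    refine level_succ_induction (P := (level A S N (d + 1)).comap (A s t))
      fun s' hs' t' ht' z hz => ?_
    rw [Submodule.mem_comap, hA.apply]
    refine sub_mem (add_mem (lower_mem_level hs' ht' (ih s hs t ht z hz)) ?_) ?_
    · split_ifs
      · exact levi_mem_level hA hN _ _ _ (by simp [hs, hs']) z hz
      · exact zero_mem _
    · split_ifs
      · exact levi_mem_level hA hN _ _ _ (by simp [ht, ht']) z hz
      · exact zero_mem _

/-- This replaces the triangular decomposition: a Levi-stable space annihilated by the raising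
operators generates a submodule by lowering alone. It is applied both to the extremal line and to
the space of singular vectors in a given level. -/
theorem iSup_level_stable (hA : IsGlRep A)
    (hN : ∀ a b, (a ∈ S ↔ b ∈ S) → ∀ z ∈ N, A a b z ∈ N)
    (hN' : ∀ s ∈ S, ∀ t, t ∉ S → ∀ z ∈ N, A s t z = 0) (a b : I) :
    ∀ z ∈ ⨆ d, level A S N d, A a b z ∈ ⨆ d, level A S N d := by
  change _ ≤ (⨆ d, level A S N d).comap (A a b)
  refine iSup_le fun d z hz => ?_
  rw [Submodule.mem_comap]
  by_cases ha : a ∈ S <;> by_cases hb : b ∈ S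
  · exact Submodule.mem_iSup_of_mem d (levi_mem_level hA hN d a b (by simp [ha, hb]) z hz)
  · cases d with
    | zero => rw [hN' a ha b hb z hz]; exact zero_mem _
    | succ d => exact Submodule.mem_iSup_of_mem d (raise_mem_level hA hN hN' d a ha b hb z hz)
  · exact Submodule.mem_iSup_of_mem (d + 1) (lower_mem_level hb ha hz)
  · exact Submodule.mem_iSup_of_mem d (levi_mem_level hA hN d a b (by simp [ha, hb]) z hz)

/-- The operator `∑_{s ∈ S} E_{s,s}`, whose eigenspaces are the levels. -/
def gradingOp (A : I → I → Module.End ℂ X) (S : Finset I) : Module.End ℂ X := ∑ s ∈ S, A s s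

theorem gradingOp_apply (hA : IsGlRep A) (a b : I) (z : X) :
    gradingOp A S (A a b z) =
      A a b (gradingOp A S z) + (if a ∈ S then A a b z else 0) - (if b ∈ S then A a b z else 0) := by
  simp only [gradingOp, LinearMap.sum_apply, map_sum]
  rw [Finset.sum_congr rfl fun s _ => hA.apply s s a b z, Finset.sum_sub_distrib,
    Finset.sum_add_distrib]
  congr 1
  · congr 1
    rw [← Finset.sum_ite_eq' S a fun _ => A a b z]
    exact Finset.sum_congr rfl fun s _ => by split_ifs with h <;> simp [h]
  · rw [← Finset.sum_ite_eq S b fun _ => A a b z]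
    exact Finset.sum_congr rfl fun s _ => by split_ifs with h <;> simp [h]

/-- A lowering operator removes one index of `S` and so decreases the eigenvalue by one. All
directness statements below rest on this. -/
theorem level_le_eigenspace (hA : IsGlRep A) {μ : ℂ}
    (hN : N ≤ (gradingOp A S).eigenspace μ) (d : ℕ) :
    level A S N d ≤ (gradingOp A S).eigenspace (μ - d) := by
  induction d with
  | zero => simpa [level] using hN
  | succ d ih =>
    refine level_succ_induction fun s hs t ht z hz => ?_
    have := Module.End.mem_eigenspace_iff.1 (ih hz)
    rw [Module.End.mem_eigenspace_iff, gradingOp_apply hA, this, if_neg ht, if_pos hs, map_smul]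
    push_cast
    module

theorem IsExtremal.gradingOp_eq {ℓ : ℂ} {x : X} (hx : IsExtremal A S ℓ x) :
    gradingOp A S x = (ℓ * S.card) • x := by
  rw [gradingOp, LinearMap.sum_apply, Finset.sum_congr rfl fun s hs => hx.diag_mem s hs,
    Finset.sum_const, ← Nat.cast_smul_eq_nsmul ℂ, smul_smul, mul_comm]

theorem IsExtremal.level_le_eigenspace (hA : IsGlRep A) {ℓ : ℂ} {x : X}
    (hx : IsExtremal A S ℓ x) (d : ℕ) :
    level A S (ℂ ∙ x) d ≤ (gradingOp A S).eigenspace (ℓ * S.card - d) := by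
  refine AbelianizedDemazure.level_le_eigenspace hA ?_ d
  rw [Submodule.span_singleton_le_iff_mem, Module.End.mem_eigenspace_iff]
  exact hx.gradingOp_eq

theorem IsExtremal.levi_mem_span {ℓ : ℂ} {x : X} (hx : IsExtremal A S ℓ x) (a b : I)
    (hab : a ∈ S ↔ b ∈ S) : ∀ z ∈ ℂ ∙ x, A a b z ∈ ℂ ∙ x := by
  intro z hz
  obtain ⟨c, rfl⟩ := Submodule.mem_span_singleton.1 hz
  rw [map_smul]
  refine Submodule.smul_mem _ _ ?_
  by_cases h : a = b
  · subst h
    by_cases ha : a ∈ S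
    · rw [hx.diag_mem a ha]
      exact Submodule.smul_mem _ _ (Submodule.mem_span_singleton_self x)
    · rw [hx.diag_notMem a ha]
      exact zero_mem _
  · rw [hx.kill a b h hab.2]
    exact zero_mem _

theorem IsExtremal.raise_span {ℓ : ℂ} {x : X} (hx : IsExtremal A S ℓ x) (s : I) (hs : s ∈ S)
    (t : I) (ht : t ∉ S) : ∀ z ∈ ℂ ∙ x, A s t z = 0 := by
  intro z hz
  obtain ⟨c, rfl⟩ := Submodule.mem_span_singleton.1 hz
  rw [map_smul, hx.kill s t (fun h => ht (h ▸ hs)) (fun _ => hs), smul_zero]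

theorem IsExtremal.iSup_level_eq_top (hA : IsGlRep A) (hs : IsSimpleFamily A) {ℓ : ℂ} {x : X}
    (hx : IsExtremal A S ℓ x) : ⨆ d, level A S (ℂ ∙ x) d = ⊤ := by
  refine (hs _ (iSup_level_stable hA hx.levi_mem_span hx.raise_span)).resolve_left fun h => ?_
  have : x ∈ ⨆ d, level A S (ℂ ∙ x) d :=
    Submodule.mem_iSup_of_mem 0 (Submodule.mem_span_singleton_self x)
  rw [h, Submodule.mem_bot] at this
  exact hx.ne_zero this

/-- The only vectors of the levels annihilated by all raising operators are the multiples of `x`. -/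
def IsNondegenerate (A : I → I → Module.End ℂ X) (S : Finset I) (x : X) : Prop :=
  ∀ d, ∀ y ∈ level A S (ℂ ∙ x) (d + 1), (∀ s ∈ S, ∀ t, t ∉ S → A s t y = 0) → y = 0

theorem eigenspace_disjoint (f : Module.End ℂ X) {μ : ℂ} {J : Type*} {ν : J → ℂ}
    (h : ∀ j, ν j ≠ μ) : Disjoint (f.eigenspace μ) (⨆ j, f.eigenspace (ν j)) :=
  (f.eigenspaces_iSupIndep μ).mono_right
    (iSup_le fun j => le_iSup₂_of_le (ν j) (h j) le_rfl)

/-- The singular vectors of level `d + 1` generate a submodule whose eigenvalues under `gradingOp`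
are at most `d + 1` steps below the top one or lower still. It misses `x`, so by simplicity it is
zero. -/
theorem IsExtremal.isNondegenerate (hA : IsGlRep A) (hs : IsSimpleFamily A) {ℓ : ℂ} {x : X}
    (hx : IsExtremal A S ℓ x) : IsNondegenerate A S x := by
  intro d y hy hy'
  let K : Submodule ℂ X :=
    level A S (ℂ ∙ x) (d + 1) ⊓ ⨅ s : S, ⨅ t : {t // t ∉ S}, LinearMap.ker (A s t)
  have hK : ∀ z, z ∈ K ↔ z ∈ level A S (ℂ ∙ x) (d + 1) ∧ ∀ s ∈ S, ∀ t, t ∉ S → A s t z = 0 := by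
    intro z
    simp [K, Submodule.mem_iInf]
  have hlevi : ∀ a b, (a ∈ S ↔ b ∈ S) → ∀ z ∈ K, A a b z ∈ K := by
    intro a b hab z hz
    rw [hK] at hz ⊢
    refine ⟨levi_mem_level hA hx.levi_mem_span _ _ _ hab z hz.1, fun s hs t ht => ?_⟩
    rw [hA.apply, hz.2 s hs t ht, map_zero, zero_add]
    split_ifs with h1 h2 h2
    · subst h1 h2
      exact absurd (hab.2 hs) ht
    · rw [hz.2 s hs b (by rw [← hab, ← h1]; exact ht), sub_zero]
    · rw [hz.2 a (by rw [hab, h2]; exact hs) t ht, sub_zero]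
    · simp
  have hraise : ∀ s ∈ S, ∀ t, t ∉ S → ∀ z ∈ K, A s t z = 0 :=
    fun s hs t ht z hz => ((hK z).1 hz).2 s hs t ht
  have hyK : y ∈ K := (hK y).2 ⟨hy, hy'⟩
  rcases hs _ (iSup_level_stable hA hlevi hraise) with h | h
  · have : y ∈ ⨆ e, level A S K e := Submodule.mem_iSup_of_mem 0 hyK
    rwa [h, Submodule.mem_bot] at this
  · exfalso
    have hKle : K ≤ (gradingOp A S).eigenspace (ℓ * S.card - ((d + 1 : ℕ) : ℂ)) :=
      inf_le_left.trans (hx.level_le_eigenspace hA (d + 1))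
    have hle : ⨆ e, level A S K e ≤
        ⨆ e : ℕ, (gradingOp A S).eigenspace (ℓ * S.card - ((d + 1 : ℕ) : ℂ) - e) :=
      iSup_mono fun e => AbelianizedDemazure.level_le_eigenspace hA hKle e
    -- The eigenvalue of `x` would have to be one of `ℓ |S| - (d + 1) - e`, which forces the
    -- positive integer `d + 1 + e` to vanish.
    have hdis : Disjoint ((gradingOp A S).eigenspace (ℓ * S.card))
        (⨆ e : ℕ, (gradingOp A S).eigenspace (ℓ * S.card - ((d + 1 : ℕ) : ℂ) - e)) := by
      refine eigenspace_disjoint _ fun e he => ?_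
      have h0 : ((d + 1 + e : ℕ) : ℂ) = 0 := by
        push_cast at he ⊢
        linear_combination -he
      exact absurd (Nat.cast_eq_zero.1 h0) (by omega)
    refine hx.ne_zero (Submodule.disjoint_def.1 hdis x
      (Module.End.mem_eigenspace_iff.2 hx.gradingOp_eq) (hle ?_))
    rw [h]
    trivial

/-! ### Subfamilies -/

section Block

variable {J : Type*} [DecidableEq J] {j : J → I} {T : Finset J}

theorem IsGlRep.block (hA : IsGlRep A) (hj : Function.Injective j) :
    IsGlRep fun a b => A (j a) (j b) := by
  intro a b c d
  simp only [hA (j a) (j b) (j c) (j d), hj.eq_iff]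

theorem IsExtremal.block {ℓ : ℂ} {x : X} (hx : IsExtremal A S ℓ x) (hj : Function.Injective j)
    (hT : ∀ a, a ∈ T ↔ j a ∈ S) : IsExtremal (fun a b => A (j a) (j b)) T ℓ x where
  ne_zero := hx.ne_zero
  kill a b hab h := hx.kill _ _ (hj.ne hab) (by rwa [← hT, ← hT])
  diag_mem a ha := hx.diag_mem _ ((hT a).1 ha)
  diag_notMem a ha := hx.diag_notMem _ (by rwa [← hT])

theorem level_block_le (hT : ∀ a, a ∈ T ↔ j a ∈ S) (d : ℕ) :
    level (fun a b => A (j a) (j b)) T N d ≤ level A S N d := by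
  induction d with
  | zero => exact le_rfl
  | succ d ih =>
    exact level_succ_induction fun s hs t ht z hz =>
      lower_mem_level ((hT s).1 hs) (by rwa [← hT]) (ih hz)

/-- As the row `p` lies outside the block, commuting `E_{p,q}` past a unit of the block leaves at
most another unit with row `p`. The induction therefore runs over all columns `q` at once; for
columns outside the block the roles are exchanged in `kill_block_right`. -/
theorem IsExtremal.kill_block_left (hA : IsGlRep A) {ℓ : ℂ} {x : X} (hx : IsExtremal A S ℓ x)
    {p : I} (hp : p ∈ S) (hpj : ∀ a, j a ≠ p) (d : ℕ) :
    ∀ q, p ≠ q → ∀ z ∈ level (fun a b => A (j a) (j b)) T (ℂ ∙ x) d, A p q z = 0 := by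
  induction d with
  | zero =>
    intro q hq z hz
    obtain ⟨c, rfl⟩ := Submodule.mem_span_singleton.1 hz
    rw [map_smul, hx.kill p q hq fun _ => hp, smul_zero]
  | succ d ih =>
    intro q hq
    refine level_succ_induction (P := LinearMap.ker (A p q)) fun s hs t ht z hz => ?_
    rw [LinearMap.mem_ker, hA.apply, ih q hq z hz, map_zero, zero_add, if_neg (hpj s), sub_zero,
      ih (j s) (hpj s).symm z hz, ite_self]

theorem IsExtremal.kill_block_right (hA : IsGlRep A) {ℓ : ℂ} {x : X} (hx : IsExtremal A S ℓ x)
    {q : I} (hq : q ∉ S) (hqj : ∀ a, j a ≠ q) (d : ℕ) :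
    ∀ p, p ≠ q → ∀ z ∈ level (fun a b => A (j a) (j b)) T (ℂ ∙ x) d, A p q z = 0 := by
  induction d with
  | zero =>
    intro p hp z hz
    obtain ⟨c, rfl⟩ := Submodule.mem_span_singleton.1 hz
    rw [map_smul, hx.kill p q hp fun h => absurd h hq, smul_zero]
  | succ d ih =>
    intro p hp
    refine level_succ_induction (P := LinearMap.ker (A p q)) fun s hs t ht z hz => ?_
    rw [LinearMap.mem_ker, hA.apply, ih p hp z hz, map_zero, zero_add, if_neg (hqj t).symm,
      zero_sub, ih (j t) (hqj t) z hz, ite_self, neg_zero]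

/-- Raising operators of the large family that leave the block annihilate the levels of the block
anyway, so a vector singular for the block is singular for the whole family. Simplicity of the
subspace generated under the block is thus not required. -/
theorem IsExtremal.isNondegenerate_block (hA : IsGlRep A) {ℓ : ℂ} {x : X}
    (hx : IsExtremal A S ℓ x) (hA' : IsNondegenerate A S x) (hT : ∀ a, a ∈ T ↔ j a ∈ S) :
    IsNondegenerate (fun a b => A (j a) (j b)) T x := by
  intro d y hy hy'
  refine hA' d y (level_block_le hT _ hy) fun s hs t ht => ?_
  have hst : s ≠ t := fun h => ht (h ▸ hs)
  by_cases h1 : ∃ a, j a = s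
  · by_cases h2 : ∃ b, j b = t
    · obtain ⟨a, rfl⟩ := h1
      obtain ⟨b, rfl⟩ := h2
      exact hy' a ((hT a).2 hs) b (by rwa [hT])
    · push Not at h2
      exact hx.kill_block_right hA ht h2 (d + 1) s hst y hy
  · push Not at h1
    exact hx.kill_block_left hA hs h1 (d + 1) t hst y hy

end Block

/-! ### Products -/

theorem IsGlRep.prodMap (hA : IsGlRep A) (hB : IsGlRep B) :
    IsGlRep fun a b => (A a b).prodMap (B a b) := by
  intro a b c d
  refine LinearMap.ext fun z => Prod.ext ?_ ?_
  · have := hA.apply a b c d z.1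
    simp only [Module.End.mul_apply, LinearMap.sub_apply, LinearMap.add_apply,
      LinearMap.prodMap_apply, Prod.fst_sub, Prod.fst_add]
    rw [this]
    split_ifs <;> simp
  · have := hB.apply a b c d z.2
    simp only [Module.End.mul_apply, LinearMap.sub_apply, LinearMap.add_apply,
      LinearMap.prodMap_apply, Prod.snd_sub, Prod.snd_add]
    rw [this]
    split_ifs <;> simp

theorem IsExtremal.prodMk {ℓ : ℂ} {x : X} {y : Y} (hx : IsExtremal A S ℓ x)
    (hy : IsExtremal B S ℓ y) : IsExtremal (fun a b => (A a b).prodMap (B a b)) S ℓ (x, y) where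
  ne_zero h := hx.ne_zero (congrArg Prod.fst h)
  kill a b h h' := by simp [hx.kill a b h h', hy.kill a b h h']
  diag_mem a h := by simp [hx.diag_mem a h, hy.diag_mem a h]
  diag_notMem a h := by simp [hx.diag_notMem a h, hy.diag_notMem a h]

/-- An equivariant linear map sends levels to levels. -/
theorem map_level {f : X →ₗ[ℂ] Y} (hf : ∀ a b z, f (A a b z) = B a b (f z)) {x : X} (d : ℕ) :
    ∀ z ∈ level A S (ℂ ∙ x) d, f z ∈ level B S (ℂ ∙ f x) d := by
  induction d with
  | zero =>
    intro z hz
    obtain ⟨c, rfl⟩ := Submodule.mem_span_singleton.1 hz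
    rw [map_smul]
    exact Submodule.smul_mem _ _ (Submodule.mem_span_singleton_self _)
  | succ d ih =>
    refine level_succ_induction (P := (level B S (ℂ ∙ f x) (d + 1)).comap f)
      fun s hs t ht z hz => ?_
    rw [Submodule.mem_comap, hf]
    exact lower_mem_level hs ht (ih z hz)

/-- An equivariant map out of a nondegenerate family is injective on the levels. -/
theorem IsNondegenerate.eq_zero_of_map {Z : Type*} [AddCommGroup Z] [Module ℂ Z]
    {C : I → I → Module.End ℂ Z} (hC : IsGlRep C) {ℓ : ℂ} {c : Z} (hc : IsExtremal C S ℓ c)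
    {f : Z →ₗ[ℂ] X} (hf : ∀ a b z, f (C a b z) = A a b (f z)) (hfc : f c ≠ 0)
    {k : Z →ₗ[ℂ] Y} (hk : ∀ a b z, k (C a b z) = B a b (k z))
    (hfk : ∀ z, f z = 0 → k z = 0 → z = 0) (hB : IsNondegenerate B S (k c)) (d : ℕ) :
    ∀ z ∈ level C S (ℂ ∙ c) d, f z = 0 → z = 0 := by
  induction d with
  | zero =>
    intro z hz hz0
    obtain ⟨r, rfl⟩ := Submodule.mem_span_singleton.1 hz
    rw [map_smul, smul_eq_zero, or_iff_left hfc] at hz0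
    rw [hz0, zero_smul]
  | succ d ih =>
    intro z hz hz0
    -- Raising `z` stays in the kernel of `f` and drops one level, where the induction hypothesis
    -- applies; hence `k z` is singular and nondegeneracy of the target `B` finishes.
    refine hfk z hz0 (hB d _ (map_level hk _ z hz) fun s hs t ht => ?_)
    have h := ih (C s t z) (raise_mem_level hC hc.levi_mem_span hc.raise_span d s hs t ht z hz)
      (by rw [hf, hz0, map_zero])
    rw [← hk, h, map_zero]

end MatrixUnits

/-! ### Lattices spanned by divided power monomials -/

section Lattices

set_option linter.unusedSectionVars false

variable {I X Y : Type*} [DecidableEq I] [AddCommGroup X] [Module ℂ X] [AddCommGroup Y] [Module ℂ Y]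

theorem divPow_neg {R : Type*} [Ring R] [Algebra ℂ R] (x : R) (m : ℕ) :
    divPow (-x) m = (-1 : ℤ) ^ m • divPow x m := by
  rw [divPow, divPow, neg_pow, smul_comm]
  congr 1
  rcases neg_one_pow_eq_or ℤ m with h | h <;> rcases Nat.even_or_odd m with h' | h' <;>
    simp_all [h'.neg_one_pow]

theorem divPow_succ_apply_eq_zero {f : Module.End ℂ X} {z : X} (h : f z = 0) {m : ℕ} (hm : m ≠ 0) :
    divPow f m z = 0 := by
  obtain ⟨m, rfl⟩ := Nat.exists_eq_succ_of_ne_zero hm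
  rw [divPow, LinearMap.smul_apply, pow_succ, Module.End.mul_apply, h, map_zero, smul_zero]

theorem map_divPow_apply {f : Module.End ℂ X} {k : Module.End ℂ Y} {u : X →ₗ[ℂ] Y}
    (h : ∀ z, u (f z) = k (u z)) (m : ℕ) (z : X) : u (divPow f m z) = divPow k m (u z) := by
  have : ∀ m z, u ((f ^ m) z) = (k ^ m) (u z) := by
    intro m
    induction m with
    | zero => simp
    | succ m ih =>
      intro z
      rw [pow_succ, pow_succ, Module.End.mul_apply, Module.End.mul_apply, ih, h]
  rw [divPow, divPow, LinearMap.smul_apply, LinearMap.smul_apply, map_smul, this]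

/-- The divided power monomials of degree `d` in the operators `A t s`, `s ∈ S`, `t ∉ S`, applied to
the vector `x`. -/
inductive IsMonomial (A : I → I → Module.End ℂ X) (S : Finset I) (x : X) : ℕ → X → Prop
  | base : IsMonomial A S x 0 x
  | step {s t : I} (hs : s ∈ S) (ht : t ∉ S) (m : ℕ) {d : ℕ} {z : X} (hz : IsMonomial A S x d z) :
      IsMonomial A S x (d + m) (divPow (A t s) m z)

/-- The `ℤ`-span of the divided power monomials of degree `d`. -/
def lattice (A : I → I → Module.End ℂ X) (S : Finset I) (x : X) (d : ℕ) : Submodule ℤ X :=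
  Submodule.span ℤ {z | IsMonomial A S x d z}

variable {A : I → I → Module.End ℂ X} {B : I → I → Module.End ℂ Y} {S : Finset I} {x : X}

theorem lattice_le {d : ℕ} {P : Submodule ℤ X} (h : ∀ z, IsMonomial A S x d z → z ∈ P) :
    lattice A S x d ≤ P :=
  Submodule.span_le.2 h

theorem self_mem_lattice : x ∈ lattice A S x 0 := Submodule.subset_span .base

theorem lower_mem_lattice {s t : I} (hs : s ∈ S) (ht : t ∉ S) (m : ℕ) {d : ℕ} {z : X}
    (hz : z ∈ lattice A S x d) : divPow (A t s) m z ∈ lattice A S x (d + m) := by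
  have : lattice A S x d ≤
      (lattice A S x (d + m)).comap ((divPow (A t s) m).restrictScalars ℤ) :=
    lattice_le fun z hz => Submodule.subset_span (IsMonomial.step hs ht m hz)
  exact this hz

theorem divPow_lower_mem_level {s t : I} (hs : s ∈ S) (ht : t ∉ S) {N : Submodule ℂ X} (m : ℕ)
    {d : ℕ} {z : X} (hz : z ∈ level A S N d) : divPow (A t s) m z ∈ level A S N (d + m) := by
  rw [divPow, LinearMap.smul_apply]
  refine Submodule.smul_mem _ _ ?_
  induction m with
  | zero => simpa using hz
  | succ m ih =>
    rw [pow_succ', Module.End.mul_apply]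
    exact lower_mem_level hs ht ih

theorem mem_level_of_mem_lattice {d : ℕ} {z : X} (hz : z ∈ lattice A S x d) :
    z ∈ level A S (ℂ ∙ x) d := by
  have : lattice A S x d ≤ (level A S (ℂ ∙ x) d).restrictScalars ℤ := by
    clear hz
    refine lattice_le fun z hz => ?_
    rw [Submodule.restrictScalars_mem]
    induction hz with
    | base => exact Submodule.mem_span_singleton_self x
    | step hs ht m _ ih => exact divPow_lower_mem_level hs ht m ih
  exact this hz

theorem map_mem_lattice {f : X →ₗ[ℂ] Y} (hf : ∀ a b z, f (A a b z) = B a b (f z)) {d : ℕ} {z : X}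
    (hz : z ∈ lattice A S x d) : f z ∈ lattice B S (f x) d := by
  have : lattice A S x d ≤ (lattice B S (f x) d).comap (f.restrictScalars ℤ) := by
    clear hz
    refine lattice_le fun z hz => ?_
    rw [Submodule.mem_comap]
    induction hz with
    | base => exact self_mem_lattice
    | step hs ht m _ ih =>
      rw [LinearMap.restrictScalars_apply, map_divPow_apply (hf _ _)]
      exact lower_mem_lattice hs ht m ih
  exact this hz

/-- Monomials lift letter by letter. This supplies the surjectivity of the projections from the
lattice in the product. -/
theorem lattice_le_map {f : X →ₗ[ℂ] Y} (hf : ∀ a b z, f (A a b z) = B a b (f z)) {d : ℕ} :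
    lattice B S (f x) d ≤ (lattice A S x d).map (f.restrictScalars ℤ) := by
  refine lattice_le fun z hz => ?_
  induction hz with
  | base => exact ⟨x, self_mem_lattice, rfl⟩
  | step hs ht m _ ih =>
    obtain ⟨y, hy, rfl⟩ := ih
    refine ⟨divPow (A _ _) m y, lower_mem_lattice hs ht m hy, ?_⟩
    rw [LinearMap.restrictScalars_apply, map_divPow_apply (hf _ _)]
    rfl

/-- Divided powers of the off-diagonal operators of the Levi subalgebra preserve the lattices. -/
theorem levi_mem_lattice (hA : IsGlRep A) {ℓ : ℂ} (hx : IsExtremal A S ℓ x) {a b : I} (hab : a ≠ b)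
    (h : a ∈ S ↔ b ∈ S) (m : ℕ) {d : ℕ} {z : X} (hz : z ∈ lattice A S x d) :
    divPow (A a b) m z ∈ lattice A S x d := by
  have key : ∀ z, IsMonomial A S x d z → ∀ m, divPow (A a b) m z ∈ lattice A S x d := by
    clear hz
    intro z hz
    induction hz with
    | base =>
      intro m
      rcases eq_or_ne m 0 with rfl | hm
      · rw [divPow_zero]
        exact self_mem_lattice
      · rw [divPow_succ_apply_eq_zero (hx.kill a b hab h.2) hm]
        exact zero_mem _
    | @step s t hs ht k d z hz ih =>
      intro m
      have hst : s ≠ t := fun e => ht (e ▸ hs)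
      -- A nonzero commutator `C` is `A a s` or `-A t b`, again lowering up to sign and commuting
      -- with both factors. `divPow_reorder` trades `r` steps of each factor for `r` steps of `C`,
      -- integrally, and the total degree stays `d + k`.
      have aux : ∀ C : Module.End ℂ X, A a b * A t s = A t s * A a b + C →
          Commute (A a b) C → Commute (A t s) C →
          (∀ r e, ∀ y ∈ lattice A S x e, divPow C r y ∈ lattice A S x (e + r)) →
          divPow (A a b) m (divPow (A t s) k z) ∈ lattice A S x (d + k) := by
        intro C hC h1 h2 h3
        rw [← Module.End.mul_apply, divPow_reorder hC h1 h2, LinearMap.sum_apply]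
        refine sum_mem fun r _ => ?_
        rw [reorderTerm]
        split_ifs with hr
        · rw [mul_assoc, (divPow_commute h1 _ _).eq, ← mul_assoc, (divPow_commute h2 _ _).eq,
            mul_assoc, Module.End.mul_apply, Module.End.mul_apply]
          have := h3 r _ _ (lower_mem_lattice hs ht (k - r) (ih (m - r)))
          rwa [show d + (k - r) + r = d + k by omega] at this
        · exact zero_mem _
      have hcomm := hA a b t s
      by_cases hbt : b = t
      · subst hbt
        have has : s ≠ a := fun e => ht (h.1 (e ▸ hs))
        have haS : a ∉ S := fun e => ht (h.1 e)
        rw [if_pos rfl, if_neg has, sub_zero] at hcomm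
        refine aux _ hcomm ?_ ?_ fun r e y hy => lower_mem_lattice hs haS r hy
        · have := hA a b a s
          rwa [if_neg hab.symm, if_neg has, add_zero, sub_zero] at this
        · have := hA b s a s
          rwa [if_neg has, if_neg hst, add_zero, sub_zero] at this
      · by_cases hsa : s = a
        · subst hsa
          have hbS : b ∈ S := h.1 hs
          rw [if_pos rfl, if_neg hbt, add_zero, sub_eq_add_neg] at hcomm
          refine aux _ hcomm ?_ ?_ fun r e y hy => ?_
          · have := hA s b t b
            rw [if_neg hbt, if_neg hab.symm, add_zero, sub_zero] at this
            exact Commute.neg_right this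
          · have := hA t s t b
            rw [if_neg hst, if_neg hbt, add_zero, sub_zero] at this
            exact Commute.neg_right this
          · rw [divPow_neg, LinearMap.smul_apply]
            exact Submodule.smul_mem _ _ (lower_mem_lattice hbS ht r hy)
        · rw [if_neg hbt, if_neg hsa, add_zero, sub_zero] at hcomm
          rw [← Module.End.mul_apply, (divPow_commute hcomm m k).eq, Module.End.mul_apply]
          exact lower_mem_lattice hs ht k (ih m)
  have : lattice A S x d ≤ (lattice A S x d).comap ((divPow (A a b) m).restrictScalars ℤ) :=
    lattice_le fun z hz => key z hz m
  exact this hz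

/-- A derivation-type relation `[h, f] = c f` gives `[h, f^{(m)}] = m c f^{(m)}`. -/
theorem apply_divPow_of_comm {h f : Module.End ℂ X} {c : ℂ} (hf : h * f = f * h + c • f) (m : ℕ)
    (z : X) : h (divPow f m z) = divPow f m (h z) + (m * c) • divPow f m z := by
  have key : ∀ m : ℕ, h * f ^ m = f ^ m * h + (m * c) • f ^ m := by
    intro m
    induction m with
    | zero => simp
    | succ m ih =>
      rw [pow_succ, ← mul_assoc, ih, add_mul, mul_assoc, hf, mul_add, ← mul_assoc, mul_smul_comm,
        smul_mul_assoc, add_assoc, ← add_smul]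
      congr 2
      push_cast
      ring
  have := DFunLike.congr_fun (key m) z
  simp only [Module.End.mul_apply, LinearMap.add_apply, LinearMap.smul_apply] at this
  rw [divPow, LinearMap.smul_apply, LinearMap.smul_apply, map_smul, this, smul_add, smul_comm]

/-- Binomial elements act on integral eigenvectors by integers. -/
theorem binomElt_apply {h : Module.End ℂ X} {c : ℤ} {z : X} (hz : h z = (c : ℂ) • z) (m : ℕ) :
    binomElt h m z = Ring.choose c m • z := by
  have h1 : (descPochhammer ℂ m).eval (c : ℂ) = (m ! : ℂ) * ((Ring.choose c m : ℤ) : ℂ) := by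
    have := Ring.descPochhammer_eq_factorial_smul_choose c m
    rw [← Polynomial.eval_eq_smeval, nsmul_eq_mul] at this
    rw [← descPochhammer_map (Int.castRingHom ℂ), Polynomial.eval_intCast_map, Int.cast_id, this]
    simp
  rw [binomElt, LinearMap.smul_apply, Module.End.aeval_apply_of_mem_apply_eq_smul hz, smul_smul,
    ← Int.cast_smul_eq_zsmul ℂ, h1, ← mul_assoc,
    inv_mul_cancel₀ (by exact_mod_cast m.factorial_ne_zero), one_mul]

end Lattices

/-! ### Matrix units on modules over `𝔰𝔩_N` -/

section SlModules

set_option linter.unusedSectionVars false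

attribute [local instance 100] LieRing.ofAssociativeRing

variable {N : ℕ}

/-- The index set of the fundamental weight `ω_k`. -/
def initialSet (N k : ℕ) : Finset (Fin N) := Finset.univ.filter fun t => (t : ℕ) < k

theorem mem_initialSet {k : ℕ} {t : Fin N} : t ∈ initialSet N k ↔ (t : ℕ) < k := by
  simp [initialSet]

theorem card_initialSet {k : ℕ} (h : k ≤ N) : (initialSet N k).card = k := by
  rw [initialSet, Fin.card_filter_val_lt, min_eq_right h]

/-- The projection of `𝔤𝔩_N` to `𝔰𝔩_N` along the scalar matrices. -/
def slProj (N : ℕ) [NeZero N] : Matrix (Fin N) (Fin N) ℂ →ₗ[ℂ] SlN N where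
  toFun M := ⟨M - (M.trace / N) • 1, by
    have : (N : ℂ) ≠ 0 := Nat.cast_ne_zero.2 (NeZero.ne N)
    change Matrix.traceLinearMap _ ℂ ℂ _ = 0
    simp [this]⟩
  map_add' M M' := by
    apply Subtype.ext
    simp only [Matrix.trace_add, AddMemClass.coe_add]
    rw [add_div]
    module
  map_smul' c M := by
    apply Subtype.ext
    simp only [Matrix.trace_smul, RingHom.id_apply, smul_eq_mul, SetLike.val_smul]
    rw [mul_div_assoc]
    module

variable [NeZero N]

theorem slProj_val (M : Matrix (Fin N) (Fin N) ℂ) :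
    (slProj N M : Matrix (Fin N) (Fin N) ℂ) = M - (M.trace / N) • 1 := rfl

theorem trace_coe_sl (x : SlN N) : (x : Matrix (Fin N) (Fin N) ℂ).trace = 0 := x.2

theorem slProj_of_trace_eq_zero {M : Matrix (Fin N) (Fin N) ℂ} (h : M.trace = 0) :
    (slProj N M : Matrix (Fin N) (Fin N) ℂ) = M := by
  simp [slProj_val, h]

theorem slProj_coe (x : SlN N) : slProj N (x : Matrix (Fin N) (Fin N) ℂ) = x :=
  Subtype.ext (slProj_of_trace_eq_zero (trace_coe_sl x))

theorem slProj_single {a b : Fin N} (h : a ≠ b) : slProj N (Matrix.single a b 1) = elemMat a b h := by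
  apply Subtype.ext
  rw [slProj_of_trace_eq_zero (Matrix.trace_single_eq_of_ne a b 1 h)]
  rfl

theorem slProj_single_self (a : Fin N) :
    (slProj N (Matrix.single a a 1) : Matrix (Fin N) (Fin N) ℂ) =
      Matrix.diagonal fun t => (if t = a then 1 else 0) - (N : ℂ)⁻¹ := by
  rw [slProj_val]
  ext p q
  simp only [Matrix.sub_apply, Matrix.smul_apply, Matrix.diagonal_apply, Matrix.single_apply,
    Matrix.one_apply, Matrix.trace_single_eq_same]
  by_cases h : p = q <;> grind [smul_eq_mul]

/-- The scalar corrections are central, and a commutator is already traceless. -/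
theorem lie_slProj (M M' : Matrix (Fin N) (Fin N) ℂ) :
    ⁅slProj N M, slProj N M'⁆ = slProj N (M * M' - M' * M) := by
  apply Subtype.ext
  have h : (M * M' - M' * M).trace = 0 := by rw [Matrix.trace_sub, Matrix.trace_mul_comm, sub_self]
  rw [slProj_of_trace_eq_zero h, LieAlgebra.SpecialLinear.sl_bracket, slProj_val, slProj_val]
  simp only [mul_sub, sub_mul, mul_smul_comm, smul_mul_assoc, mul_one, one_mul]
  module

variable {V : Type*} [AddCommGroup V] [Module ℂ V] [LieRingModule (SlN N) V]
  [LieModule ℂ (SlN N) V]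

variable (V) in
/-- The action of the matrix unit `E_{a,b}` when the identity matrix acts by `N κ`. -/
def matUnit (κ : ℂ) (a b : Fin N) : Module.End ℂ V :=
  LieModule.toEnd ℂ (SlN N) V (slProj N (Matrix.single a b 1)) + if a = b then κ • 1 else 0

theorem matUnit_of_ne (κ : ℂ) {a b : Fin N} (h : a ≠ b) :
    matUnit V κ a b = LieModule.toEnd ℂ (SlN N) V (elemMat a b h) := by
  rw [matUnit, if_neg h, add_zero, slProj_single h]

/-- The scalars drop out of every commutator on the left, and on the right they occur only in the
difference of two diagonal units, where they cancel. The parameter `κ` is therefore free to be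
adapted to the weight. -/
theorem isGlRep_matUnit (κ : ℂ) : IsGlRep (matUnit (N := N) V κ) := by
  intro a b c d
  have h := LieHom.map_lie (LieModule.toEnd ℂ (SlN N) V) (slProj N (Matrix.single a b 1))
    (slProj N (Matrix.single c d 1))
  have e1 : Matrix.single a b (1 : ℂ) * Matrix.single c d 1 =
      if b = c then Matrix.single a d 1 else 0 := by
    split_ifs with h
    · subst h; simp
    · simp [h]
  have e2 : Matrix.single c d (1 : ℂ) * Matrix.single a b 1 =
      if d = a then Matrix.single c b 1 else 0 := by
    split_ifs with h
    · subst h; simp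
    · simp [h]
  rw [lie_slProj, e1, e2, LieRing.of_associative_ring_bracket, map_sub, map_sub] at h
  have hc : ∀ (P : Prop) [Decidable P] (f : Module.End ℂ V),
      Commute (if P then κ • (1 : Module.End ℂ V) else 0) f := by
    intro P _ f
    split_ifs
    · exact (Commute.one_left f).smul_left κ
    · exact Commute.zero_left f
  have key : matUnit V κ a b * matUnit V κ c d - matUnit V κ c d * matUnit V κ a b =
      (if b = c then matUnit V κ a d else 0) - (if d = a then matUnit V κ c b else 0) := by
    have l1 : matUnit V κ a b * matUnit V κ c d - matUnit V κ c d * matUnit V κ a b =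
        LieModule.toEnd ℂ (SlN N) V (slProj N (Matrix.single a b 1)) *
          LieModule.toEnd ℂ (SlN N) V (slProj N (Matrix.single c d 1)) -
        LieModule.toEnd ℂ (SlN N) V (slProj N (Matrix.single c d 1)) *
          LieModule.toEnd ℂ (SlN N) V (slProj N (Matrix.single a b 1)) := by
      simp only [matUnit, add_mul, mul_add]
      rw [(hc (a = b) (if c = d then κ • 1 else 0)).eq, (hc (a = b) _).eq,
        (hc (c = d) (LieModule.toEnd ℂ (SlN N) V (slProj N (Matrix.single a b 1)))).eq]
      abel
    rw [l1, ← h]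
    by_cases h1 : b = c <;> by_cases h2 : d = a
    · subst h1 h2
      simp [matUnit]
    · subst h1
      simp [matUnit, h2, Ne.symm h2]
    · subst h2
      simp [matUnit, h1, eq_comm]
    · simp [h1, h2]
  rw [add_sub_assoc, ← key]
  abel

theorem isSimpleFamily_matUnit [LieModule.IsIrreducible ℂ (SlN N) V] (κ : ℂ) :
    IsSimpleFamily (matUnit (N := N) V κ) := by
  intro U hU
  have hU' : ∀ a b, ∀ z ∈ U,
      LieModule.toEnd ℂ (SlN N) V (slProj N (Matrix.single a b 1)) z ∈ U := by
    intro a b z hz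
    have := hU a b z hz
    rw [matUnit, LinearMap.add_apply] at this
    refine (U.add_mem_iff_left ?_).1 this
    split_ifs
    · exact U.smul_mem κ hz
    · exact U.zero_mem
  let U' : LieSubmodule ℂ (SlN N) V :=
    { U with
      lie_mem := by
        intro x z hz
        have hx : x = ∑ a, ∑ b, (x : Matrix (Fin N) (Fin N) ℂ) a b •
            slProj N (Matrix.single a b 1) := by
          conv_lhs => rw [← slProj_coe x, Matrix.matrix_eq_sum_single x.1, map_sum]
          refine Finset.sum_congr rfl fun a _ => ?_
          rw [map_sum]
          refine Finset.sum_congr rfl fun b _ => ?_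
          rw [← map_smul, Matrix.smul_single, smul_eq_mul, mul_one]
        change ⁅x, z⁆ ∈ U
        rw [← LieModule.toEnd_apply_apply ℂ, hx]
        simp only [map_sum, LinearMap.sum_apply, map_smul, LinearMap.smul_apply]
        exact sum_mem fun a _ => sum_mem fun b _ => U.smul_mem _ (hU' a b z hz) }
  rcases eq_bot_or_eq_top U' with h | h
  · exact Or.inl (congrArg LieSubmodule.toSubmodule h)
  · exact Or.inr (congrArg LieSubmodule.toSubmodule h)

theorem weightVal_single (k : Set.Ioo 0 N) (ℓ : ℤ) (d : Fin N → ℂ) :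
    weightVal (Pi.single k ℓ) d = ℓ * ∑ t : Fin N, if (t : ℕ) < k then d t else 0 := by
  rw [weightVal, Finset.sum_eq_single k]
  · simp
  · intro b _ hb
    simp [hb]
  · simp

theorem Psi_single {n : ℕ} (i : Set.Ioo 0 n) (ℓ : ℤ) :
    Psi (Pi.single i ℓ) =
      Pi.single ⟨2 * (i : ℕ), by have := i.2.1; omega, by have := i.2.2; omega⟩ ℓ := by
  rw [Psi, Finset.sum_eq_single i]
  · simp
  · intro b _ hb
    simp [hb]
  · simp

/-- The value of the weight `ℓ ω_k` on the traceless part of `E_{a,a}`. -/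
theorem weightVal_slProj_single (k : Set.Ioo 0 N) (ℓ : ℤ) (a : Fin N) :
    weightVal (Pi.single k ℓ) (fun t => (if t = a then 1 else 0) - (N : ℂ)⁻¹) =
      (if a ∈ initialSet N k then (ℓ : ℂ) else 0) - ℓ * k / N := by
  rw [weightVal_single, ← Finset.sum_filter, ← initialSet, Finset.sum_sub_distrib,
    Finset.sum_ite_eq', Finset.sum_const, card_initialSet k.2.2.le, nsmul_eq_mul]
  split_ifs <;> ring

/-- For the `𝔰𝔩₂`-triple of the root, `v` is primitive of weight `0`, and in finite dimension the
first power of the lowering element already annihilates such a vector. -/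
theorem IsHighestWeightVector.lower_eq_zero [FiniteDimensional ℂ V] {μ : IntWeight N} {v : V}
    (hv : IsHighestWeightVector μ v) {p q : Fin N} (h : p < q)
    (hpq : weightVal μ (fun t => (if t = p then 1 else 0) - (if t = q then 1 else 0)) = 0) :
    ⁅elemMat q p h.ne', v⁆ = 0 := by
  let H : SlN N := ⁅elemMat p q h.ne, elemMat q p h.ne'⁆
  have hH : (H : Matrix (Fin N) (Fin N) ℂ) =
      Matrix.diagonal fun t => (if t = p then 1 else 0) - (if t = q then 1 else 0) := by
    change ((⁅elemMat p q h.ne, elemMat q p h.ne'⁆ : SlN N) : Matrix (Fin N) (Fin N) ℂ) = _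
    rw [LieAlgebra.SpecialLinear.sl_bracket]
    ext a b
    simp only [elemMat, LieAlgebra.SpecialLinear.val_single, Matrix.single_mul_single_same,
      Matrix.sub_apply, Matrix.single_apply, Matrix.diagonal_apply]
    grind
  have t : IsSl2Triple H (elemMat p q h.ne) (elemMat q p h.ne') :=
    { h_ne_zero := by
        intro h0
        have := congrArg (fun x : SlN N => (x : Matrix (Fin N) (Fin N) ℂ) p p) h0
        simp [hH, h.ne] at this
      lie_e_f := rfl
      lie_h_e_nsmul := by
        apply Subtype.ext
        rw [LieAlgebra.SpecialLinear.sl_bracket, hH]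
        ext a b
        simp only [elemMat, LieAlgebra.SpecialLinear.val_single, Matrix.sub_apply,
          Matrix.diagonal_mul, Matrix.mul_diagonal,
          Matrix.single_apply, two_smul, AddMemClass.coe_add, Matrix.add_apply]
        grind
      lie_h_f_nsmul := by
        apply Subtype.ext
        rw [LieAlgebra.SpecialLinear.sl_bracket, hH]
        ext a b
        simp only [elemMat, LieAlgebra.SpecialLinear.val_single, Matrix.sub_apply,
          Matrix.diagonal_mul, Matrix.mul_diagonal, NegMemClass.coe_neg, Matrix.neg_apply,
          Matrix.single_apply, two_smul, AddMemClass.coe_add, Matrix.add_apply]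
        grind }
  have P : t.HasPrimitiveVectorWith v (0 : ℂ) :=
    { ne_zero := hv.ne_zero
      lie_h := by rw [hv.weight _ H hH, hpq]
      lie_e := hv.raising p q h }
  simpa using P.pow_toEnd_f_eq_zero_of_eq_nat (n := 0) (by simp)

/-- The scalar `ℓ k / N` offsets the trace correction in `slProj`, which makes `E_{a,a}` act by
exactly `ℓ` or `0`. Lower triangular Levi units annihilate `v` because the weight vanishes on their
coroots. -/
theorem IsHighestWeightVector.isExtremal [FiniteDimensional ℂ V] {k : Set.Ioo 0 N} {ℓ : ℤ} {v : V}
    (hv : IsHighestWeightVector (Pi.single k ℓ) v) :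
    IsExtremal (matUnit (N := N) V (ℓ * k / N)) (initialSet N k) ℓ v := by
  have hdiag : ∀ a : Fin N, matUnit (N := N) V (ℓ * k / N) a a v =
      (if a ∈ initialSet N k then (ℓ : ℂ) else 0) • v := by
    intro a
    rw [matUnit, if_pos rfl, LinearMap.add_apply, LieModule.toEnd_apply_apply,
      hv.weight _ _ (slProj_single_self a), weightVal_slProj_single, LinearMap.smul_apply,
      Module.End.one_apply, ← add_smul, sub_add_cancel]
  refine ⟨hv.ne_zero, fun a b hab h => ?_, fun a ha => by rw [hdiag, if_pos ha],
    fun a ha => by rw [hdiag, if_neg ha, zero_smul]⟩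
  rw [matUnit_of_ne _ hab, LieModule.toEnd_apply_apply]
  rcases lt_or_gt_of_ne hab with h1 | h1
  · exact hv.raising a b h1
  · refine hv.lower_eq_zero h1 ?_
    rw [weightVal_single, ← Finset.sum_filter, ← initialSet, Finset.sum_sub_distrib,
      Finset.sum_ite_eq', Finset.sum_ite_eq']
    have : a ∈ initialSet N k ↔ b ∈ initialSet N k := by
      refine ⟨fun ha => ?_, h⟩
      rw [mem_initialSet] at *
      exact lt_trans h1 ha
    simp [this]

end SlModules

/-! ### Extremal vectors and the Weyl group -/

section Weyl

theorem IsExtremal.eq_zero_of_gradingOp {I X : Type*} [DecidableEq I] [AddCommGroup X] [Module ℂ X]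
    {A : I → I → Module.End ℂ X} {S : Finset I} {ℓ : ℂ} {x z : X} (hA : IsGlRep A)
    (hs : IsSimpleFamily A) (hx : IsExtremal A S ℓ x)
    (hz : gradingOp A S z = (ℓ * S.card + 1) • z) : z = 0 := by
  have hdis := eigenspace_disjoint (gradingOp A S) (μ := ℓ * S.card + 1)
    (ν := fun d : ℕ => ℓ * S.card - d) fun d hd => by
      have h0 : ((d + 1 : ℕ) : ℂ) = 0 := by
        push_cast
        linear_combination -hd
      exact absurd (Nat.cast_eq_zero.1 h0) (by omega)
  refine Submodule.disjoint_def.1 hdis z (Module.End.mem_eigenspace_iff.2 hz)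
    ((iSup_mono fun d => hx.level_le_eigenspace hA d : ⨆ d, level A S (ℂ ∙ x) d ≤ _) ?_)
  rw [hx.iSup_level_eq_top hA hs]
  trivial

/-- Levels exhaust the space and only level `0`, the line of `x`, carries the top eigenvalue; the
component in positive levels must vanish. -/
theorem IsExtremal.mem_span_of_gradingOp {I X : Type*} [DecidableEq I] [AddCommGroup X]
    [Module ℂ X] {A : I → I → Module.End ℂ X} {S : Finset I} {ℓ : ℂ} {x z : X} (hA : IsGlRep A)
    (hs : IsSimpleFamily A) (hx : IsExtremal A S ℓ x)
    (hz : gradingOp A S z = (ℓ * S.card) • z) : z ∈ ℂ ∙ x := by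
  have hdis := eigenspace_disjoint (gradingOp A S) (μ := ℓ * S.card)
    (ν := fun d : ℕ => ℓ * S.card - ((d + 1 : ℕ) : ℂ)) fun d hd => by
      have h0 : ((d + 1 : ℕ) : ℂ) = 0 := by linear_combination -hd
      exact absurd (Nat.cast_eq_zero.1 h0) (by omega)
  have hz' : z ∈ level A S (ℂ ∙ x) 0 ⊔ ⨆ d, level A S (ℂ ∙ x) (d + 1) := by
    rw [sup_iSup_nat_succ, hx.iSup_level_eq_top hA hs]
    trivial
  obtain ⟨y, hy, y', hy', rfl⟩ := Submodule.mem_sup.1 hz'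
  have h0 : y' = 0 := by
    refine Submodule.disjoint_def.1 hdis y' ?_
      ((iSup_mono fun d => hx.level_le_eigenspace hA (d + 1)) hy')
    have hy0 := hx.level_le_eigenspace hA 0 hy
    rw [Nat.cast_zero, sub_zero] at hy0
    exact (Submodule.add_mem_iff_right _ hy0).1 (Module.End.mem_eigenspace_iff.2 hz)
  rwa [h0, add_zero]

/-- An operator that permutes the diagonal matrix units sends extremal vectors to extremal
vectors. -/
theorem IsExtremal.map_perm {I X : Type*} [DecidableEq I] [AddCommGroup X] [Module ℂ X]
    {A : I → I → Module.End ℂ X} {S : Finset I} {ℓ : ℂ} {x : X} (hA : IsGlRep A)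
    (hs : IsSimpleFamily A) (hx : IsExtremal A S ℓ x) {g : (Module.End ℂ X)ˣ} {w : Equiv.Perm I}
    (hg : ∀ a z, (g : Module.End ℂ X) (A a a z) = A (w a) (w a) ((g : Module.End ℂ X) z)) :
    IsExtremal A (S.map w.toEmbedding) ℓ ((g : Module.End ℂ X) x) := by
  have hinv : ∀ z, (g : Module.End ℂ X) ((↑g⁻¹ : Module.End ℂ X) z) = z := fun z => by
    rw [← Module.End.mul_apply, Units.mul_inv, Module.End.one_apply]
  have hinv' : ∀ z, (↑g⁻¹ : Module.End ℂ X) ((g : Module.End ℂ X) z) = z := fun z => by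
    rw [← Module.End.mul_apply, Units.inv_mul, Module.End.one_apply]
  have hg' : ∀ a z, A a a ((↑g⁻¹ : Module.End ℂ X) z) =
      (↑g⁻¹ : Module.End ℂ X) (A (w a) (w a) z) := fun a z => by
    rw [← hinv' (A a a _), hg, hinv]
  have hmem : ∀ a, w a ∈ S.map w.toEmbedding ↔ a ∈ S := fun a => by simp
  have hdiag : ∀ c, A c c x = (if c ∈ S then ℓ else 0) • x := fun c => by
    split_ifs with h
    · exact hx.diag_mem c h
    · rw [hx.diag_notMem c h, zero_smul]
  refine ⟨fun h => hx.ne_zero ?_, fun a b hab h => ?_, fun a ha => ?_, fun a ha => ?_⟩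
  · rw [← hinv' x, h, map_zero]
  · obtain ⟨a, rfl⟩ := w.surjective a
    obtain ⟨b, rfl⟩ := w.surjective b
    rw [hmem, hmem] at h
    replace hab : a ≠ b := fun e => hab (e ▸ rfl)
    -- Only the diagonal units are known to be permuted by `g`, so the argument uses weights: `u`
    -- has the weight of `x` plus `ε_a - ε_b`, and it suffices to show that this weight does not
    -- occur.
    set u := (↑g⁻¹ : Module.End ℂ X) (A (w a) (w b) ((g : Module.End ℂ X) x)) with hu
    have hcu : ∀ c, A c c u = ((if c ∈ S then ℓ else 0) + (if c = a then 1 else 0) -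
        (if c = b then 1 else 0)) • u := by
      intro c
      rw [hu, hg', hA.apply, ← hg, hdiag, map_smul, map_smul, map_sub, map_add, map_smul]
      simp only [w.injective.eq_iff, eq_comm (a := b) (b := c)]
      rw [sub_smul, add_smul]
      congr 1
      · congr 1
        split_ifs with h1
        · rw [h1, one_smul]
        · rw [map_zero, zero_smul]
      · split_ifs with h1
        · rw [h1, one_smul]
        · rw [map_zero, zero_smul]
    have hgr : gradingOp A S u = (ℓ * S.card + (if a ∈ S then 1 else 0) -
        (if b ∈ S then 1 else 0)) • u := by
      rw [gradingOp, LinearMap.sum_apply, Finset.sum_congr rfl fun c _ => hcu c, ← Finset.sum_smul,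
        Finset.sum_sub_distrib, Finset.sum_add_distrib, Finset.sum_ite_eq', Finset.sum_ite_eq',
        Finset.sum_congr rfl fun c hc => if_pos hc, Finset.sum_const, nsmul_eq_mul,
        mul_comm (S.card : ℂ)]
    have hu0 : u = 0 := by
      by_cases h1 : a ∈ S ∧ b ∉ S
      · rw [if_pos h1.1, if_neg h1.2, sub_zero] at hgr
        exact hx.eq_zero_of_gradingOp hA hs hgr
      · have h2 : a ∈ S ↔ b ∈ S := by tauto
        simp only [h2, add_sub_cancel_right] at hgr
        -- Here `u` has the top grading eigenvalue and so is a multiple of `x`, but its eigenvalue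
        -- under `A a a` exceeds that of `x` by one.
        obtain ⟨c, hc⟩ := Submodule.mem_span_singleton.1 (hx.mem_span_of_gradingOp hA hs hgr)
        have h3 := hcu a
        rw [if_pos rfl, if_neg hab, sub_zero, add_smul, one_smul] at h3
        have h4 : A a a u = (if a ∈ S then ℓ else 0) • u := by
          rw [← hc, map_smul, hdiag, smul_comm]
        rwa [h4, left_eq_add] at h3
    rw [← hinv (A _ _ _), ← hu, hu0, map_zero]
  · obtain ⟨a, rfl⟩ := w.surjective a
    rw [← hg, hx.diag_mem a ((hmem a).1 ha), map_smul]
  · obtain ⟨a, rfl⟩ := w.surjective a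
    rw [← hg, hx.diag_notMem a (by rwa [← hmem]), map_zero]

theorem IsWeylRepresentative.apply_matUnit {N : ℕ} [NeZero N] {V : Type*} [AddCommGroup V]
    [Module ℂ V] [LieRingModule (SlN N) V] [LieModule ℂ (SlN N) V] {w : Equiv.Perm (Fin N)}
    {g : (Module.End ℂ V)ˣ} (hg : IsWeylRepresentative w g) (κ : ℂ) (a : Fin N) (z : V) :
    (g : Module.End ℂ V) (matUnit V κ a a z) =
      matUnit V κ (w a) (w a) ((g : Module.End ℂ V) z) := by
  have h := DFunLike.congr_fun (hg.conj _ _ _ (slProj_single_self a) (by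
    rw [slProj_single_self (w a)]
    congr 1
    ext t
    simp only [Equiv.symm_apply_eq])) z
  rw [Module.End.mul_apply, Module.End.mul_apply] at h
  simp only [matUnit, if_pos, LinearMap.add_apply, map_add, h, LinearMap.smul_apply, map_smul,
    Module.End.one_apply]

end Weyl

/-! ### The Demazure module as a sum of lattices -/

section DemazureLattice

attribute [local instance 100] LieRing.ofAssociativeRing

section

variable {N : ℕ} {V : Type*} [AddCommGroup V] [Module ℂ V] [LieRingModule (SlN N) V]
  [LieModule ℂ (SlN N) V]

theorem uAct_ι (x : SlN N) :
    uAct V (UniversalEnvelopingAlgebra.ι ℂ x) = LieModule.toEnd ℂ (SlN N) V x := by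
  rw [uAct, UniversalEnvelopingAlgebra.lift_ι_apply]

theorem uAct_divPow (u : UN N) (m : ℕ) : uAct V (divPow u m) = divPow (uAct V u) m := by
  rw [divPow, divPow, map_smul, map_pow]

theorem uAct_binomElt (u : UN N) (m : ℕ) : uAct V (binomElt u m) = binomElt (uAct V u) m := by
  rw [binomElt, binomElt, map_smul, Polynomial.aeval_algHom_apply]

theorem uAct_divPow_rootVec [NeZero N] (κ : ℂ) {p q : Fin N} (h : p ≠ q) (m : ℕ) :
    uAct V (divPow (rootVec p q h) m) = divPow (matUnit V κ p q) m := by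
  rw [uAct_divPow, rootVec, uAct_ι, matUnit_of_ne κ h]

theorem uAct_simpleCoroot [NeZero N] (κ : ℂ) (j : ℕ) (h : j + 1 < N) :
    uAct V (simpleCoroot j h : UN N) =
      matUnit (N := N) V κ ⟨j, by omega⟩ ⟨j, by omega⟩ - matUnit V κ ⟨j + 1, h⟩ ⟨j + 1, h⟩ := by
  rw [simpleCoroot, uAct_ι, matUnit, matUnit, if_pos rfl, if_pos rfl, add_sub_add_right_eq_sub,
    ← map_sub, ← map_sub, ← slProj_coe (LieAlgebra.SpecialLinear.singleSubSingle _ _ _)]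
  rfl

end

variable {n : ℕ}

/-- The position in `{1, …, 2n}` of the index `a` of the copy of `𝔰𝔩_n` that contains the root
vectors `E_{φ(α)}` acting nontrivially on the Demazure module. -/
def blockIndex (n i : ℕ) (a : Fin n) : Fin (2 * n) :=
  if (a : ℕ) < i then ⟨n + a, by omega⟩ else ⟨a, by omega⟩

theorem blockIndex_val (i : ℕ) (a : Fin n) :
    (blockIndex n i a : ℕ) = if (a : ℕ) < i then n + a else a := by
  unfold blockIndex
  split_ifs <;> rfl

theorem blockIndex_injective (i : ℕ) : Function.Injective (blockIndex n i) := by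
  intro a b h
  have h' := congrArg Fin.val h
  rw [blockIndex_val, blockIndex_val] at h'
  ext
  split_ifs at h' <;> omega

/-- The index set of the weight `τ(ω̃_{2i})`. -/
def tauSet (n i : ℕ) : Finset (Fin (2 * n)) := (initialSet (2 * n) (2 * i)).map (tau n).toEmbedding

/-- In the zero-based numbering `tau` sends even positions `2k` to `k` and odd positions `2k + 1` to
`n + k`, so the first `2i` positions split into two runs of length `i`. -/
theorem mem_tauSet {i : ℕ} (hi : i < n) {t : Fin (2 * n)} :
    t ∈ tauSet n i ↔ (t : ℕ) < i ∨ (n ≤ (t : ℕ) ∧ (t : ℕ) < n + i) := by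
  have : t ∈ tauSet n i ↔ (((tau n).symm t : Fin (2 * n)) : ℕ) < 2 * i := by
    rw [tauSet, Finset.mem_map_equiv, mem_initialSet]
  rw [this]
  change ((if h : (t : ℕ) < n then (⟨2 * t, by omega⟩ : Fin (2 * n))
    else ⟨2 * (t - n) + 1, by omega⟩ : Fin (2 * n)) : ℕ) < 2 * i ↔ _
  split_ifs <;> simp only <;> omega

theorem mem_initialSet_iff_blockIndex {i : ℕ} (hi : i < n) (a : Fin n) :
    a ∈ initialSet n i ↔ blockIndex n i a ∈ tauSet n i := by
  rw [mem_tauSet hi, mem_initialSet, blockIndex_val]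
  split_ifs <;> omega

theorem exists_blockIndex {i : ℕ} (p : Fin (2 * n)) (h1 : i ≤ (p : ℕ))
    (h2 : (p : ℕ) < n + i) : ∃ a, blockIndex n i a = p := by
  by_cases h : (p : ℕ) < n
  · refine ⟨⟨p, h⟩, Fin.ext ?_⟩
    rw [blockIndex_val, if_neg (by simpa using h1)]
  · refine ⟨⟨p - n, by omega⟩, Fin.ext ?_⟩
    rw [blockIndex_val, if_pos (by simp; omega)]
    simp
    omega

theorem blockIndex_ne_of_lt {i : ℕ} (hi : i < n) {p : Fin (2 * n)} (h : (p : ℕ) < i) (a : Fin n) :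
    blockIndex n i a ≠ p := by
  intro e
  have := congrArg Fin.val e
  rw [blockIndex_val] at this
  split_ifs at this <;> omega

theorem blockIndex_ne_of_le {i : ℕ} {p : Fin (2 * n)} (h : n + i ≤ (p : ℕ)) (a : Fin n) :
    blockIndex n i a ≠ p := by
  intro e
  have := congrArg Fin.val e
  rw [blockIndex_val] at this
  split_ifs at this <;> omega

variable {W : Type*} [AddCommGroup W] [Module ℂ W] [LieRingModule (SlN (2 * n)) W]
  [LieModule ℂ (SlN (2 * n)) W] [NeZero (2 * n)]

variable (W) in
/-- The matrix units of the copy of `𝔤𝔩_n` in `𝔤𝔩_{2n}` with index set `blockIndex`. -/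
def blockUnit (κ : ℂ) (i : ℕ) (a b : Fin n) : Module.End ℂ W :=
  matUnit W κ (blockIndex n i a) (blockIndex n i b)

/-- Root vectors of the Borel subalgebra outside of the block annihilate its levels. -/
theorem IsExtremal.kill_outside {κ : ℂ} {i : ℕ} (hi : i < n) {ℓ : ℂ} {x : W}
    (hx : IsExtremal (matUnit (N := 2 * n) W κ) (tauSet n i) ℓ x) {p q : Fin (2 * n)} (hpq : p ≠ q)
    (h : (p : ℕ) < i ∨ n + i ≤ (q : ℕ)) {d : ℕ} {z : W}
    (hz : z ∈ level (blockUnit W κ i) (initialSet n i) (ℂ ∙ x) d) : matUnit W κ p q z = 0 := by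
  rcases h with h | h
  · exact hx.kill_block_left (isGlRep_matUnit κ) ((mem_tauSet hi).2 (Or.inl h))
      (blockIndex_ne_of_lt hi h) d q hpq z hz
  · exact hx.kill_block_right (isGlRep_matUnit κ) (by rw [mem_tauSet hi]; omega)
      (blockIndex_ne_of_le h) d p hpq z hz

/-- Integrality of these eigenvalues is what makes the binomial elements of the torus preserve the
`ℤ`-lattices. -/
theorem isMonomial_eigenvector {κ : ℂ} {i : ℕ} {ℓ : ℤ} {x : W}
    (hx : IsExtremal (matUnit (N := 2 * n) W κ) (tauSet n i) ℓ x) (p : Fin (2 * n)) {d : ℕ} {z : W}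
    (hz : IsMonomial (blockUnit W κ i) (initialSet n i) x d z) :
    ∃ c : ℤ, matUnit W κ p p z = (c : ℂ) • z := by
  induction hz with
  | base =>
    by_cases hp : p ∈ tauSet n i
    · exact ⟨ℓ, hx.diag_mem p hp⟩
    · exact ⟨0, by rw [hx.diag_notMem p hp, Int.cast_zero, zero_smul]⟩
  | @step s t hs ht m d z hz ih =>
    obtain ⟨c, hc⟩ := ih
    have hcomm : matUnit W κ p p * blockUnit W κ i t s = blockUnit W κ i t s * matUnit W κ p p +
        ((if p = blockIndex n i t then 1 else 0) - (if blockIndex n i s = p then 1 else 0) : ℂ) •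
          blockUnit W κ i t s := by
      rw [blockUnit, isGlRep_matUnit κ p p, sub_smul, add_sub_assoc]
      congr 2
      · split_ifs with h
        · rw [h, one_smul]
        · rw [zero_smul]
      · split_ifs with h
        · rw [h, one_smul]
        · rw [zero_smul]
    refine ⟨c + m * ((if p = blockIndex n i t then 1 else 0) -
      (if blockIndex n i s = p then 1 else 0)), ?_⟩
    rw [apply_divPow_of_comm hcomm, hc, map_smul, ← add_smul]
    push_cast
    rfl

/-- The sum of the lattices contains `v_τ` and is stable under each generator of `U_ℤ(𝔟)`, by cases
on its position relative to the block. Conversely, all lowering operators of the block are upper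
triangular in `𝔰𝔩_{2n}`. -/
theorem demazure_eq_iSup_lattice {κ : ℂ} {i : ℕ} (hi : i < n) {ℓ : ℤ} {w : W}
    {g : (Module.End ℂ W)ˣ}
    (hx : IsExtremal (matUnit (N := 2 * n) W κ) (tauSet n i) ℓ ((g : Module.End ℂ W) w)) :
    demazure (2 * n) g w =
      ⨆ d, lattice (blockUnit W κ i) (initialSet n i) ((g : Module.End ℂ W) w) d := by
  set x := (g : Module.End ℂ W) w with hxdef
  set L := ⨆ d, lattice (blockUnit W κ i) (initialSet n i) x d
  have hB : IsGlRep (blockUnit (n := n) W κ i) := (isGlRep_matUnit κ).block (blockIndex_injective i)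
  have hxB : IsExtremal (blockUnit W κ i) (initialSet n i) ℓ x :=
    hx.block (blockIndex_injective i) (mem_initialSet_iff_blockIndex hi)
  have hle : ∀ d, lattice (blockUnit W κ i) (initialSet n i) x d ≤ L := fun d => le_iSup _ d
  apply le_antisymm
  · have key : ∀ u ∈ hyperBorel (2 * n), ∀ z ∈ L, uAct W u z ∈ L := by
      intro u hu
      induction hu using Algebra.adjoin_induction with
      | mem u hu =>
        have red : (∀ d z, IsMonomial (blockUnit W κ i) (initialSet n i) x d z → uAct W u z ∈ L) →
            ∀ z ∈ L, uAct W u z ∈ L := by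
          intro h
          change L ≤ L.comap ((uAct W u).restrictScalars ℤ)
          exact iSup_le fun d => lattice_le fun z hz => h d z hz
        refine red fun d z hz => ?_
        have hzl : z ∈ lattice (blockUnit W κ i) (initialSet n i) x d := Submodule.subset_span hz
        rcases hu with ⟨p, q, hpq, m, rfl⟩ | ⟨j, hj, m, rfl⟩
        · rw [uAct_divPow_rootVec κ]
          by_cases hout : (p : ℕ) < i ∨ n + i ≤ (q : ℕ)
          · rcases eq_or_ne m 0 with rfl | hm
            · rw [divPow_zero]
              exact hle d hzl
            · rw [divPow_succ_apply_eq_zero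
                (hx.kill_outside hi hpq.ne hout (mem_level_of_mem_lattice hzl)) hm]
              exact zero_mem _
          · have hpq' : (p : ℕ) < q := hpq
            obtain ⟨a, rfl⟩ := exists_blockIndex (i := i) p (by omega) (by omega)
            obtain ⟨b, rfl⟩ := exists_blockIndex (i := i) q (by omega) (by omega)
            change divPow (blockUnit W κ i a b) m z ∈ L
            by_cases ha : a ∈ initialSet n i <;> by_cases hb : b ∈ initialSet n i
            · exact hle d (levi_mem_lattice hB hxB (fun e => hpq.ne (congrArg _ e))
                (by simp [ha, hb]) m hzl)
            -- A raising unit of the block has its row at `n + a` and its column at `b < n`, so it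
            -- lies below the diagonal and is not in the Borel subalgebra.
            · exfalso
              rw [mem_initialSet] at ha hb
              rw [blockIndex_val, blockIndex_val, if_pos ha, if_neg hb] at hpq'
              omega
            · exact hle _ (lower_mem_lattice hb ha m hzl)
            · exact hle d (levi_mem_lattice hB hxB (fun e => hpq.ne (congrArg _ e))
                (by simp [ha, hb]) m hzl)
        · rw [uAct_binomElt, uAct_simpleCoroot κ]
          obtain ⟨c, hc⟩ := isMonomial_eigenvector hx ⟨j, by omega⟩ hz
          obtain ⟨c', hc'⟩ := isMonomial_eigenvector hx ⟨j + 1, hj⟩ hz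
          rw [binomElt_apply (c := c - c') (by
            rw [LinearMap.sub_apply, hc, hc', Int.cast_sub, sub_smul])]
          exact L.smul_mem _ (hle d hzl)
      | algebraMap r =>
        intro z hz
        rw [Algebra.algebraMap_eq_smul_one, map_zsmul, map_one]
        exact L.smul_mem r hz
      | add u u' _ _ h h' =>
        intro z hz
        rw [map_add, LinearMap.add_apply]
        exact add_mem (h z hz) (h' z hz)
      | mul u u' _ _ h h' =>
        intro z hz
        rw [map_mul, Module.End.mul_apply]
        exact h _ (h' z hz)
    rintro _ ⟨u, hu, rfl⟩
    exact key u hu x (hle 0 self_mem_lattice)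
  · refine iSup_le fun d => lattice_le fun z hz => ?_
    induction hz with
    | base => exact ⟨1, one_mem (hyperBorel (2 * n)), by simp [orbitMap, hxdef]⟩
    | @step s t hs ht m d z _ ih =>
      have hts : blockIndex n i t < blockIndex n i s := by
        rw [mem_initialSet] at hs ht
        rw [Fin.lt_def, blockIndex_val, blockIndex_val, if_pos hs, if_neg ht]
        omega
      rw [blockUnit, ← uAct_divPow_rootVec κ hts.ne]
      exact demazure_stable g w (Algebra.subset_adjoin (Or.inl ⟨_, _, hts, m, rfl⟩)) ih

end DemazureLattice

/-! ### The PBW filtration as a sum of lattices -/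

section Dual

variable {I X : Type*} [DecidableEq I] [AddCommGroup X] [Module ℂ X]
  {A : I → I → Module.End ℂ X} {S : Finset I}

/-- The family dual to `A`, twisted by a permutation `r` of the indices and by a multiple of the
trace. -/
def dualUnit (A : I → I → Module.End ℂ X) (r : Equiv.Perm I) (c : ℂ) (a b : I) : Module.End ℂ X :=
  -A (r b) (r a) + if a = b then c • 1 else 0

theorem dualUnit_of_ne (r : Equiv.Perm I) (c : ℂ) {a b : I} (h : a ≠ b) :
    dualUnit A r c a b = -A (r b) (r a) := by
  rw [dualUnit, if_neg h, add_zero]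

/-- Negative transposition composed with a permutation of the indices is a Lie algebra automorphism,
and the scalar `c` cancels as it does in `isGlRep_matUnit`. -/
theorem IsGlRep.dualUnit (hA : IsGlRep A) (r : Equiv.Perm I) (c : ℂ) :
    IsGlRep (dualUnit A r c) := by
  intro a b d e
  have hc : ∀ (P : Prop) [Decidable P] (f : Module.End ℂ X),
      Commute (if P then c • (1 : Module.End ℂ X) else 0) f := by
    intro P _ f
    split_ifs
    · exact (Commute.one_left f).smul_left c
    · exact Commute.zero_left f
  have l1 : AbelianizedDemazure.dualUnit A r c a b * AbelianizedDemazure.dualUnit A r c d e -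
      AbelianizedDemazure.dualUnit A r c d e * AbelianizedDemazure.dualUnit A r c a b =
      A (r b) (r a) * A (r e) (r d) - A (r e) (r d) * A (r b) (r a) := by
    simp only [AbelianizedDemazure.dualUnit, add_mul, mul_add]
    rw [(hc (a = b) (if d = e then c • 1 else 0)).eq, (hc (a = b) _).eq,
      (hc (d = e) (-A (r b) (r a))).eq, neg_mul_neg, neg_mul_neg]
    abel
  have key : A (r b) (r a) * A (r e) (r d) - A (r e) (r d) * A (r b) (r a) =
      (if b = d then AbelianizedDemazure.dualUnit A r c a e else 0) -
        (if e = a then AbelianizedDemazure.dualUnit A r c d b else 0) := by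
    rw [hA, add_sub_assoc, add_sub_cancel_left]
    simp only [r.injective.eq_iff]
    by_cases h1 : b = d <;> by_cases h2 : e = a
    · subst h1 h2
      simp only [AbelianizedDemazure.dualUnit, if_true]
      abel
    · subst h1
      simp [AbelianizedDemazure.dualUnit, h2, Ne.symm h2]
    · subst h2
      simp [AbelianizedDemazure.dualUnit, h1, Ne.symm h1]
    · simp [h1, h2, Ne.symm h1, Ne.symm h2]
  rw [add_sub_assoc, ← key, ← l1]
  abel

theorem IsSimpleFamily.dualUnit (hA : IsSimpleFamily A) (r : Equiv.Perm I) (c : ℂ) :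
    IsSimpleFamily (dualUnit A r c) := by
  intro U hU
  refine hA U fun a b z hz => ?_
  have h := hU (r.symm b) (r.symm a) z hz
  rw [AbelianizedDemazure.dualUnit, LinearMap.add_apply, r.apply_symm_apply,
    r.apply_symm_apply] at h
  have h2 : (if r.symm b = r.symm a then c • (1 : Module.End ℂ X) else 0) z ∈ U := by
    split_ifs
    · exact U.smul_mem c hz
    · exact U.zero_mem
  exact U.neg_mem_iff.1 ((U.add_mem_iff_left h2).1 h)

/-- Negation followed by the shift by `ℓ` exchanges the diagonal eigenvalues `ℓ` and `0`, so the
support becomes the complement, moved by `r`. With `r` the reversal this turns `ℓ ω_{n-i}` into `ℓ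
ω_i`. -/
theorem IsExtremal.dualUnit {ℓ : ℂ} {x : X} (hx : IsExtremal A S ℓ x) (r : Equiv.Perm I)
    {T : Finset I} (hT : ∀ a, a ∈ T ↔ r a ∉ S) : IsExtremal (dualUnit A r ℓ) T ℓ x where
  ne_zero := hx.ne_zero
  kill a b hab h := by
    rw [dualUnit_of_ne r ℓ hab, LinearMap.neg_apply,
      hx.kill _ _ (r.injective.ne hab.symm) (by rw [hT, hT] at h; tauto), neg_zero]
  diag_mem a ha := by
    rw [AbelianizedDemazure.dualUnit, if_pos rfl, LinearMap.add_apply, LinearMap.neg_apply,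
      hx.diag_notMem _ ((hT a).1 ha), neg_zero, zero_add]
    rfl
  diag_notMem a ha := by
    rw [hT, not_not] at ha
    rw [AbelianizedDemazure.dualUnit, if_pos rfl, LinearMap.add_apply, LinearMap.neg_apply,
      hx.diag_mem _ ha]
    exact neg_add_cancel _

end Dual

/-! ### PBW degree and lattice degree on the twisted module. -/

section PBW

set_option linter.unusedSectionVars false

variable {n : ℕ} [NeZero n] {V : Type*} [AddCommGroup V] [Module ℂ V] [LieRingModule (SlN n) V]
  [LieModule ℂ (SlN n) V]

variable (V) in
/-- The matrix units of `𝔤𝔩_n` on `V`, twisted by the Chevalley involution and `w₀`. -/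
def twistedUnit (κ ℓ : ℂ) : Fin n → Fin n → Module.End ℂ V := dualUnit (matUnit V κ) Fin.revPerm ℓ

theorem isGlRep_twistedUnit (κ ℓ : ℂ) : IsGlRep (twistedUnit (n := n) V κ ℓ) :=
  (isGlRep_matUnit κ).dualUnit _ _

theorem uAct_divPow_lowVec (κ ℓ : ℂ) (α : PosRoot n) (m : ℕ) :
    uAct V (divPow (lowVec α) m) =
      (-1 : ℤ) ^ m • divPow (twistedUnit V κ ℓ (Fin.rev α.1.1) (Fin.rev α.1.2)) m := by
  rw [lowVec, uAct_divPow_rootVec κ, ← divPow_neg, twistedUnit,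
    dualUnit_of_ne _ _ (Fin.rev_injective.ne α.2.ne), neg_neg, Fin.revPerm_apply, Fin.revPerm_apply,
    Fin.rev_rev, Fin.rev_rev]

/-- The sum of the lattices of degree at most `d`. -/
def latticeLE {I X : Type*} [AddCommGroup X] [Module ℂ X] (A : I → I → Module.End ℂ X)
    (S : Finset I) (x : X) (d : ℤ) : Submodule ℤ X :=
  ⨆ e : {e : ℕ // (e : ℤ) ≤ d}, lattice A S x e

theorem lattice_le_latticeLE {I X : Type*} [AddCommGroup X] [Module ℂ X]
    {A : I → I → Module.End ℂ X} {S : Finset I} {x : X} {e : ℕ} {d : ℤ} (h : (e : ℤ) ≤ d) :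
    lattice A S x e ≤ latticeLE A S x d :=
  le_iSup (fun e : {e : ℕ // (e : ℤ) ≤ d} => lattice A S x e) ⟨e, h⟩

/-- A root vector of the Levi subalgebra preserves the lattices. -/
theorem uAct_levi_mem_lattice {κ ℓ : ℂ} {i : ℕ} {v : V}
    (hv : IsExtremal (twistedUnit (n := n) V κ ℓ) (initialSet n i) ℓ v) {α : PosRoot n}
    (hα : Fin.rev α.1.1 ∈ initialSet n i ↔ Fin.rev α.1.2 ∈ initialSet n i) (m : ℕ) {d : ℕ} {z : V}
    (hz : z ∈ lattice (twistedUnit (n := n) V κ ℓ) (initialSet n i) v d) :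
    uAct V (divPow (lowVec α) m) z ∈
      lattice (twistedUnit (n := n) V κ ℓ) (initialSet n i) v d := by
  rw [uAct_divPow_lowVec κ ℓ, LinearMap.smul_apply]
  exact Submodule.smul_mem _ _ (levi_mem_lattice (isGlRep_twistedUnit κ ℓ) hv
    (Fin.rev_injective.ne α.2.ne) hα m hz)

theorem uAct_lower_mem_lattice {κ ℓ : ℂ} {i : ℕ} {v : V} {α : PosRoot n}
    (h1 : Fin.rev α.1.1 ∉ initialSet n i) (h2 : Fin.rev α.1.2 ∈ initialSet n i) (m : ℕ) {d : ℕ}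
    {z : V} (hz : z ∈ lattice (twistedUnit (n := n) V κ ℓ) (initialSet n i) v d) :
    uAct V (divPow (lowVec α) m) z ∈
      lattice (twistedUnit (n := n) V κ ℓ) (initialSet n i) v (d + m) := by
  rw [uAct_divPow_lowVec κ ℓ, LinearMap.smul_apply]
  exact Submodule.smul_mem _ _ (lower_mem_lattice h2 h1 m hz)

/-- This excludes the raising case: in the twisted family every `f_α` is lowering or Levi. -/
theorem rev_mem_initialSet {i : ℕ} (α : PosRoot n) (h : Fin.rev α.1.1 ∈ initialSet n i) :
    Fin.rev α.1.2 ∈ initialSet n i := by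
  rw [mem_initialSet] at *
  exact lt_trans (Fin.lt_def.1 (Fin.rev_lt_rev.2 α.2)) h

/-- Read a word from the right: a lowering letter `f_α^{(m)}` adds `m` to the lattice degree and a
Levi letter adds nothing, so the lattice degree never exceeds the PBW degree. A monomial in lowering
operators is, up to sign, itself a word of its own degree. -/
theorem pbwFilt_eq_latticeLE {κ ℓ : ℂ} {i : ℕ} {v : V}
    (hv : IsExtremal (twistedUnit (n := n) V κ ℓ) (initialSet n i) ℓ v) (d : ℤ) :
    pbwFilt n v d = latticeLE (twistedUnit (n := n) V κ ℓ) (initialSet n i) v d := by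
  apply le_antisymm
  · rw [pbwFilt, pbw, Submodule.map_span]
    refine Submodule.span_le.2 ?_
    rintro _ ⟨_, ⟨l, hl, rfl⟩, rfl⟩
    have key : ∀ l : List (PosRoot n × ℕ), uAct V (lowWord l) v ∈
        latticeLE (twistedUnit (n := n) V κ ℓ) (initialSet n i) v (wordDeg l) := by
      intro l
      induction l with
      | nil =>
        simp only [lowWord, List.map_nil, List.prod_nil, map_one]
        exact lattice_le_latticeLE (by simp) self_mem_lattice
      | cons r l ih =>
        obtain ⟨α, m⟩ := r
        have h1 : lowWord ((α, m) :: l) = divPow (lowVec α) m * lowWord l := by simp [lowWord]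
        have h2 : wordDeg ((α, m) :: l) = m + wordDeg l := by simp [wordDeg]
        rw [h1, h2, map_mul, Module.End.mul_apply]
        have : latticeLE (twistedUnit (n := n) V κ ℓ) (initialSet n i) v (wordDeg l) ≤
            (latticeLE (twistedUnit (n := n) V κ ℓ) (initialSet n i) v
              ((m + wordDeg l : ℕ) : ℤ)).comap
                ((uAct V (divPow (lowVec α) m)).restrictScalars ℤ) := by
          refine iSup_le fun e z hz => ?_
          rw [Submodule.mem_comap, LinearMap.restrictScalars_apply]
          have he := e.2
          by_cases hα : Fin.rev α.1.1 ∈ initialSet n i ↔ Fin.rev α.1.2 ∈ initialSet n i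
          · exact lattice_le_latticeLE (by push_cast at *; omega) (uAct_levi_mem_lattice hv hα m hz)
          · have h3 := rev_mem_initialSet (i := i) α
            exact lattice_le_latticeLE (by push_cast at *; omega)
              (uAct_lower_mem_lattice (by tauto) (by tauto) m hz)
        exact this ih
    have h := key l
    have hmono : latticeLE (twistedUnit (n := n) V κ ℓ) (initialSet n i) v (wordDeg l) ≤
        latticeLE (twistedUnit (n := n) V κ ℓ) (initialSet n i) v d :=
      iSup_le fun e => lattice_le_latticeLE (e.2.trans hl)
    exact hmono h
  · refine iSup_le fun ⟨e, he⟩ => le_trans (lattice_le fun z hz => ?_) (pbwFilt_mono he)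
    change IsMonomial _ _ _ e z at hz
    clear he
    induction hz with
    | base => exact ⟨1, Submodule.subset_span ⟨[], by simp [wordDeg], by simp [lowWord]⟩,
        by simp [orbitMap]⟩
    | @step s t hs ht m d z _ ih =>
      have hst : Fin.rev t < Fin.rev s := by
        rw [mem_initialSet] at hs ht
        rw [Fin.rev_lt_rev, Fin.lt_def]
        omega
      have h := low_mem v ⟨(Fin.rev t, Fin.rev s), hst⟩ m d ih
      rw [uAct_divPow_lowVec κ ℓ, LinearMap.smul_apply] at h
      simp only [Fin.rev_rev] at h
      have h' := Submodule.smul_mem _ ((-1 : ℤ) ^ m) h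
      rwa [smul_smul, ← mul_pow, neg_one_mul, neg_neg, one_pow, one_smul] at h'

end PBW

/-! ### The comparison -/

section Comparison

variable {I X Y : Type*} [DecidableEq I] [AddCommGroup X] [Module ℂ X] [AddCommGroup Y] [Module ℂ Y]

/-- The sum of the lattices generated by an extremal vector is direct, also after pulling it back
along maps that are injective on each summand. -/
theorem toModule_lattice_injective {A : I → I → Module.End ℂ X} {S : Finset I} {ℓ : ℂ} {x : X}
    (hA : IsGlRep A) (hx : IsExtremal A S ℓ x) {M : ℕ → Type*} [∀ d, AddCommGroup (M d)]
    (f : ∀ d, M d →ₗ[ℤ] X) (hf : ∀ (d : ℕ) z, f d z ∈ lattice A S x d)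
    (hinj : ∀ d, Function.Injective (f d)) :
    Function.Injective (DirectSum.toModule ℤ ℕ X f) := by
  have hind : iSupIndep fun d : ℕ => (gradingOp A S).eigenspace (ℓ * S.card - d) :=
    (gradingOp A S).eigenspaces_iSupIndep.comp fun d e h => by
      have h' : ℓ * S.card - (d : ℂ) = ℓ * S.card - (e : ℂ) := h
      exact Nat.cast_injective (R := ℂ) (by linear_combination -h')
  have hmem : ∀ (d : ℕ) z, f d z ∈ (gradingOp A S).eigenspace (ℓ * S.card - d) := fun d z =>
    hx.level_le_eigenspace hA d (mem_level_of_mem_lattice (hf d z))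
  let k : ∀ d : ℕ, M d → (gradingOp A S).eigenspace (ℓ * S.card - d) := fun d z => ⟨f d z, hmem d z⟩
  have hk0 : ∀ d, k d 0 = 0 := fun d => Subtype.ext (map_zero (f d))
  have hk : Function.Injective (DFinsupp.mapRange k hk0) :=
    (DFinsupp.mapRange_injective k hk0).2 fun d a b h => hinj d (congrArg Subtype.val h)
  -- The map factors through the direct sum of the eigenspaces of `gradingOp`, where independence
  -- over `ℂ` is available.
  have hcomp : ∀ y : DirectSum ℕ M, DirectSum.toModule ℤ ℕ X f y =
      DFinsupp.lsum ℕ (fun d : ℕ => ((gradingOp A S).eigenspace (ℓ * S.card - d)).subtype)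
        (DFinsupp.mapRange k hk0 y) := by
    intro y
    induction y using DirectSum.induction_on with
    | zero => simp
    | of d z =>
      have : DFinsupp.mapRange k hk0 (DirectSum.of M d z) = DFinsupp.single d (k d z) :=
        DFinsupp.mapRange_single
      rw [this, DFinsupp.lsum_single]
      exact DirectSum.toModule_lof ℤ d z
    | add y y' h h' =>
      have : DFinsupp.mapRange k hk0 (y + y') =
          DFinsupp.mapRange k hk0 y + DFinsupp.mapRange k hk0 y' :=
        DFinsupp.mapRange_add k hk0 (fun d a b => Subtype.ext (map_add (f d) a b)) y y'
      rw [map_add, h, h', this, map_add]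
  intro y y' h
  rw [hcomp, hcomp] at h
  exact hk (hind.dfinsupp_lsum_injective h)

/-- Separation by eigenvalues of `gradingOp`. It gives the injectivity of `L_d → V_d / V_{d-1}`. -/
theorem disjoint_lattice_latticeLE {A : I → I → Module.End ℂ X} {S : Finset I} {ℓ : ℂ} {x : X}
    (hA : IsGlRep A) (hx : IsExtremal A S ℓ x) {d : ℕ} {z : X} (hz : z ∈ lattice A S x d)
    (hz' : z ∈ latticeLE A S x ((d : ℤ) - 1)) : z = 0 := by
  have hdis := eigenspace_disjoint (gradingOp A S) (μ := ℓ * S.card - d)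
    (ν := fun e : {e : ℕ // (e : ℤ) ≤ (d : ℤ) - 1} => ℓ * S.card - ((e : ℕ) : ℂ)) fun e he => by
      have h : ((e : ℕ) : ℂ) = d := by linear_combination -he
      have := e.2
      have := Nat.cast_injective h
      omega
  have hle : latticeLE A S x ((d : ℤ) - 1) ≤ (⨆ e : {e : ℕ // (e : ℤ) ≤ (d : ℤ) - 1},
      (gradingOp A S).eigenspace (ℓ * S.card - ((e : ℕ) : ℂ))).restrictScalars ℤ :=
    iSup_le fun e y hy => Submodule.mem_iSup_of_mem e
      (hx.level_le_eigenspace hA e (mem_level_of_mem_lattice hy))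
  exact Submodule.disjoint_def.1 hdis z
    (hx.level_le_eigenspace hA d (mem_level_of_mem_lattice hz)) (hle hz')

theorem latticeLE_le_sup {I : Type*} {A : I → I → Module.End ℂ X} {S : Finset I} {x : X} (d : ℕ) :
    latticeLE A S x d ≤ lattice A S x d ⊔ latticeLE A S x ((d : ℤ) - 1) := by
  refine iSup_le fun ⟨e, he⟩ => ?_
  change lattice A S x e ≤ _
  rcases eq_or_ne e d with rfl | h
  · exact le_sup_left
  · exact le_sup_of_le_right (lattice_le_latticeLE (by omega))

/-! ### The diagonal lattices in `W × V` and their two projections. -/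

variable {n : ℕ} [NeZero n] [NeZero (2 * n)]
  {W : Type*} [AddCommGroup W] [Module ℂ W] [LieRingModule (SlN (2 * n)) W]
  [LieModule ℂ (SlN (2 * n)) W]
  {V : Type*} [AddCommGroup V] [Module ℂ V] [LieRingModule (SlN n) V] [LieModule ℂ (SlN n) V]

variable (W V) in
/-- The block of `𝔤𝔩_{2n}` and the twisted `𝔤𝔩_n` acting on the product `W × V`. -/
def pairUnit (κ κ' ℓ : ℂ) (i : ℕ) (a b : Fin n) : Module.End ℂ (W × V) :=
  (blockUnit W κ i a b).prodMap (twistedUnit V κ' ℓ a b)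

/-- The data common to the Demazure module generated by `x` and the abelianized module generated
by `v`. -/
structure IsMatchedPair (κ κ' : ℂ) (ℓ : ℤ) (i : ℕ) (x : W) (v : V) : Prop where
  lt : i < n
  extremal : IsExtremal (matUnit (N := 2 * n) W κ) (tauSet n i) ℓ x
  simple : IsSimpleFamily (matUnit (N := 2 * n) W κ)
  extremal' : IsExtremal (twistedUnit (n := n) V κ' ℓ) (initialSet n i) ℓ v
  simple' : IsSimpleFamily (twistedUnit (n := n) V κ' ℓ)

namespace IsMatchedPair

variable {κ κ' : ℂ} {ℓ : ℤ} {i : ℕ} {x : W} {v : V}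

theorem isGlRep_block (_h : IsMatchedPair (n := n) κ κ' ℓ i x v) :
    IsGlRep (blockUnit (n := n) W κ i) :=
  (isGlRep_matUnit κ).block (blockIndex_injective i)

theorem extremal_block (h : IsMatchedPair (n := n) κ κ' ℓ i x v) :
    IsExtremal (blockUnit (n := n) W κ i) (initialSet n i) ℓ x :=
  h.extremal.block (blockIndex_injective i) (mem_initialSet_iff_blockIndex h.lt)

theorem nondegenerate_block (h : IsMatchedPair (n := n) κ κ' ℓ i x v) :
    IsNondegenerate (blockUnit (n := n) W κ i) (initialSet n i) x :=
  h.extremal.isNondegenerate_block (isGlRep_matUnit κ)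
    (h.extremal.isNondegenerate (isGlRep_matUnit κ) h.simple)
    (mem_initialSet_iff_blockIndex h.lt)

theorem isGlRep_pair (h : IsMatchedPair (n := n) κ κ' ℓ i x v) :
    IsGlRep (pairUnit (n := n) W V κ κ' ℓ i) :=
  h.isGlRep_block.prodMap (isGlRep_twistedUnit κ' ℓ)

theorem extremal_pair (h : IsMatchedPair (n := n) κ κ' ℓ i x v) :
    IsExtremal (pairUnit (n := n) W V κ κ' ℓ i) (initialSet n i) ℓ (x, v) :=
  h.extremal_block.prodMk h.extremal'

/-- Here nondegeneracy is used on the side of `V`, where it comes from simplicity of the twisted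
module; `eq_zero_of_snd` uses it on the block in `W`. -/
theorem eq_zero_of_fst (h : IsMatchedPair (n := n) κ κ' ℓ i x v) {d : ℕ} {z : W × V}
    (hz : z ∈ lattice (pairUnit (n := n) W V κ κ' ℓ i) (initialSet n i) (x, v) d)
    (h0 : z.1 = 0) : z = 0 :=
  IsNondegenerate.eq_zero_of_map (A := blockUnit (n := n) W κ i) (B := twistedUnit V κ' ℓ)
    h.isGlRep_pair h.extremal_pair
    (f := LinearMap.fst ℂ W V) (fun _ _ _ => rfl) h.extremal_block.ne_zero
    (k := LinearMap.snd ℂ W V) (fun _ _ _ => rfl) (fun _ h1 h2 => Prod.ext h1 h2)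
    (h.extremal'.isNondegenerate (isGlRep_twistedUnit κ' ℓ) h.simple') d z
    (mem_level_of_mem_lattice hz) h0

theorem eq_zero_of_snd (h : IsMatchedPair (n := n) κ κ' ℓ i x v) {d : ℕ} {z : W × V}
    (hz : z ∈ lattice (pairUnit (n := n) W V κ κ' ℓ i) (initialSet n i) (x, v) d)
    (h0 : z.2 = 0) : z = 0 :=
  IsNondegenerate.eq_zero_of_map (A := twistedUnit V κ' ℓ) (B := blockUnit (n := n) W κ i)
    h.isGlRep_pair h.extremal_pair
    (f := LinearMap.snd ℂ W V) (fun _ _ _ => rfl) h.extremal'.ne_zero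
    (k := LinearMap.fst ℂ W V) (fun _ _ _ => rfl) (fun _ h1 h2 => Prod.ext h2 h1)
    h.nondegenerate_block d z (mem_level_of_mem_lattice hz) h0

variable (n W V κ κ' ℓ i x v) in
/-- The lattice of degree `d` in `W × V` generated by `(x, v)`. -/
abbrev Pairs (d : ℕ) : Submodule ℤ (W × V) :=
  lattice (pairUnit (n := n) W V κ κ' ℓ i) (initialSet n i) (x, v) d

theorem fst_mem {d : ℕ} {z : W × V} (hz : z ∈ Pairs n W V κ κ' ℓ i x v d) :
    z.1 ∈ lattice (blockUnit (n := n) W κ i) (initialSet n i) x d :=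
  map_mem_lattice (A := pairUnit (n := n) W V κ κ' ℓ i) (x := (x, v)) (f := LinearMap.fst ℂ W V)
    (B := blockUnit (n := n) W κ i) (fun _ _ _ => rfl) hz

theorem snd_mem {d : ℕ} {z : W × V} (hz : z ∈ Pairs n W V κ κ' ℓ i x v d) :
    z.2 ∈ lattice (twistedUnit (n := n) V κ' ℓ) (initialSet n i) v d :=
  map_mem_lattice (A := pairUnit (n := n) W V κ κ' ℓ i) (x := (x, v)) (f := LinearMap.snd ℂ W V)
    (B := twistedUnit (n := n) V κ' ℓ) (fun _ _ _ => rfl) hz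

/-- The comparison of the direct sum of the lattices with the Demazure module. -/
theorem exists_equiv_demazure {w : W} {g : (Module.End ℂ W)ˣ}
    (h : IsMatchedPair (n := n) κ κ' ℓ i ((g : Module.End ℂ W) w) v) :
    ∃ e : DirectSum ℕ (fun d => Pairs n W V κ κ' ℓ i ((g : Module.End ℂ W) w) v d) ≃ₗ[ℤ]
        demazure (2 * n) g w,
      ∀ d z, (e (DirectSum.lof ℤ ℕ _ d z) : W) = (z : W × V).1 := by
  let f : ∀ d, Pairs n W V κ κ' ℓ i ((g : Module.End ℂ W) w) v d →ₗ[ℤ] W := fun d =>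
    ((LinearMap.fst ℂ W V).restrictScalars ℤ).comp (Submodule.subtype _)
  let F := DirectSum.toModule ℤ ℕ W f
  have hF : ∀ d z, F (DirectSum.lof ℤ ℕ _ d z) = (z : W × V).1 := fun d z => by
    simp only [F]
    rw [DirectSum.toModule_lof]
    rfl
  have hinj : Function.Injective F := by
    refine toModule_lattice_injective h.isGlRep_block h.extremal_block f
      (fun d z => fst_mem z.2) fun d => (injective_iff_map_eq_zero _).2 fun z hz => ?_
    exact Subtype.ext (h.eq_zero_of_fst z.2 hz)
  have hrange : LinearMap.range F = demazure (2 * n) g w := by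
    rw [demazure_eq_iSup_lattice h.lt h.extremal]
    apply le_antisymm
    · rintro _ ⟨y, rfl⟩
      induction y using DirectSum.induction_on with
      | zero => rw [map_zero]; exact zero_mem _
      | of d z =>
        refine Submodule.mem_iSup_of_mem d ?_
        have : F (DirectSum.of _ d z) = (z : W × V).1 := hF d z
        rw [this]
        exact fst_mem z.2
      | add y y' hy hy' => rw [map_add]; exact add_mem hy hy'
    · refine iSup_le fun d y hy => ?_
      obtain ⟨z, hz, rfl⟩ := lattice_le_map (A := pairUnit (n := n) W V κ κ' ℓ i)
        (B := blockUnit (n := n) W κ i) (x := ((g : Module.End ℂ W) w, v))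
        (f := LinearMap.fst ℂ W V) (fun _ _ _ => rfl) hy
      exact ⟨DirectSum.lof ℤ ℕ _ d ⟨z, hz⟩, hF d ⟨z, hz⟩⟩
  refine ⟨(LinearEquiv.ofInjective F hinj).trans (LinearEquiv.ofEq _ _ hrange), fun d z => ?_⟩
  exact hF d z

theorem snd_mem_pbwFilt (h : IsMatchedPair (n := n) κ κ' ℓ i x v) {d : ℕ} {z : W × V}
    (hz : z ∈ Pairs n W V κ κ' ℓ i x v d) : z.2 ∈ pbwFilt n v d := by
  rw [pbwFilt_eq_latticeLE h.extremal']
  exact lattice_le_latticeLE le_rfl (snd_mem hz)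

/-- The comparison of the direct sum of the lattices with the abelianized module. -/
theorem exists_equiv_abelianized (h : IsMatchedPair (n := n) κ κ' ℓ i x v) :
    ∃ e : DirectSum ℕ (fun d => Pairs n W V κ κ' ℓ i x v d) ≃ₗ[ℤ] Abelianized n v,
      ∀ d z, e (DirectSum.lof ℤ ℕ _ d z) =
        grClass v d (z : W × V).2 (h.snd_mem_pbwFilt z.2) := by
  let f : ∀ d : ℕ, Pairs n W V κ κ' ℓ i x v d →ₗ[ℤ] grPiece n v d := fun d =>
    (Submodule.mkQ _).comp ((((LinearMap.snd ℂ W V).restrictScalars ℤ).comp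
      (Submodule.subtype _)).codRestrict (pbwFilt n v d) fun z => h.snd_mem_pbwFilt z.2)
  have hf : ∀ d, Function.Bijective (f d) := by
    intro d
    constructor
    · refine (injective_iff_map_eq_zero _).2 fun z hz => ?_
      have hz' : (z : W × V).2 ∈ pbwFilt n v ((d : ℤ) - 1) :=
        (Submodule.Quotient.mk_eq_zero
          ((pbwFilt n v ((d : ℤ) - 1)).submoduleOf (pbwFilt n v d))).1 hz
      rw [pbwFilt_eq_latticeLE h.extremal'] at hz'
      exact Subtype.ext (h.eq_zero_of_snd z.2 (disjoint_lattice_latticeLE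
        (isGlRep_twistedUnit κ' ℓ) h.extremal' (snd_mem z.2) hz'))
    · intro q
      obtain ⟨⟨y, hy⟩, rfl⟩ := Submodule.Quotient.mk_surjective _ q
      have hy' := hy
      -- Modulo `V_{d-1}` only the degree `d` part of `y` survives, and it lifts to the diagonal
      -- lattice.
      rw [pbwFilt_eq_latticeLE h.extremal'] at hy'
      obtain ⟨a, ha, b, hb, rfl⟩ := Submodule.mem_sup.1 (latticeLE_le_sup d hy')
      obtain ⟨z, hz, rfl⟩ := lattice_le_map (A := pairUnit (n := n) W V κ κ' ℓ i)
        (B := twistedUnit (n := n) V κ' ℓ) (x := (x, v))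
        (f := LinearMap.snd ℂ W V) (fun _ _ _ => rfl) ha
      refine ⟨⟨z, hz⟩, (Submodule.Quotient.eq _).2 ?_⟩
      rw [← pbwFilt_eq_latticeLE h.extremal'] at hb
      change z.2 - (z.2 + b) ∈ pbwFilt n v ((d : ℤ) - 1)
      rw [sub_add_cancel_left]
      exact neg_mem hb
  refine ⟨DFinsupp.mapRange.linearEquiv fun d => LinearEquiv.ofBijective (f d) (hf d),
    fun d z => ?_⟩
  exact DFinsupp.mapRange_single (hf := fun d => map_zero (LinearEquiv.ofBijective (f d) (hf d)))

end IsMatchedPair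

end Comparison

/-! ### Compatibility with `S_ℤ(𝔫^{-,a})` through `θ`, and the isomorphism. -/

section Isomorphism

set_option linter.unusedSectionVars false

variable {n : ℕ} [NeZero n] [NeZero (2 * n)]
  {W : Type*} [AddCommGroup W] [Module ℂ W] [LieRingModule (SlN (2 * n)) W]
  [LieModule ℂ (SlN (2 * n)) W]
  {V : Type*} [AddCommGroup V] [Module ℂ V] [LieRingModule (SlN n) V] [LieModule ℂ (SlN n) V]
  {κ κ' : ℂ} {ℓ : ℤ} {i : ℕ} {x : W} {v : V}

theorem grClass_eq_zero {s : ℕ} {y : V} (hy : y ∈ pbwFilt n v s)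
    (hy' : y ∈ pbwFilt n v ((s : ℤ) - 1)) : grClass v s y hy = 0 := by
  have h0 : grClass (n := n) v s 0 (zero_mem _) = 0 := by
    unfold grClass
    exact map_zero (DirectSum.lof ℤ ℕ (grPiece n v) s)
  rw [← h0]
  exact grClass_congr rfl _ _ (by rwa [sub_zero])

theorem zsmul_grClass (c : ℤ) (s : ℕ) (y : V) (hy : y ∈ pbwFilt n v s) :
    c • grClass v s y hy = grClass v s (c • y) (zsmul_mem hy c) := by
  exact (map_zsmul (DirectSum.lof ℤ ℕ (grPiece n v) s) c (Submodule.Quotient.mk ⟨y, hy⟩)).symm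

theorem chevalleyTwist_gen_smul_grClass (α : PosRoot n) (m s : ℕ) (y : V)
    (hy : y ∈ pbwFilt n v s) :
    chevalleyTwist n (SymZ.gen α m) • grClass v s y hy =
      (-1 : ℤ) ^ m • grClass v (s + m) (uAct V (divPow (lowVec (dualRoot α)) m) y)
        (low_mem v (dualRoot α) m s hy) := by
  rw [chevalleyTwist_gen, mul_smul, gen_smul_grClass]
  rcases Nat.even_or_odd m with h | h
  · rw [h.neg_one_pow, h.neg_one_pow, one_smul, one_smul]
  · rw [h.neg_one_pow, h.neg_one_pow, neg_smul, neg_smul, one_smul, one_smul]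

theorem uAct_divPow_lowVec_dualRoot (κ ℓ : ℂ) (α : PosRoot n) (m : ℕ) :
    uAct V (divPow (lowVec (dualRoot α)) m) =
      (-1 : ℤ) ^ m • divPow (twistedUnit V κ ℓ α.1.2 α.1.1) m := by
  rw [uAct_divPow_lowVec κ ℓ]
  simp only [dualRoot, Fin.rev_rev]

theorem uAct_divPow_abelVec (κ : ℂ) (α : PosRoot n) (m : ℕ) :
    uAct W (divPow (abelVec α) m) =
      divPow (matUnit W κ (⟨α.1.2, by omega⟩ : Fin (2 * n)) ⟨n + α.1.1, by omega⟩) m := by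
  rw [abelVec, uAct_divPow_rootVec κ]

namespace IsMatchedPair

/-- The comparison isomorphisms intertwine the generators of `S_ℤ(𝔫^{-,a})`. -/
theorem equiv_gen_smul {w : W} {g : (Module.End ℂ W)ˣ}
    (h : IsMatchedPair (n := n) κ κ' ℓ i ((g : Module.End ℂ W) w) v)
    {e : DirectSum ℕ (fun d => Pairs n W V κ κ' ℓ i ((g : Module.End ℂ W) w) v d) ≃ₗ[ℤ]
      demazure (2 * n) g w}
    (he : ∀ d z, (e (DirectSum.lof ℤ ℕ _ d z) : W) = (z : W × V).1)
    {e' : DirectSum ℕ (fun d => Pairs n W V κ κ' ℓ i ((g : Module.End ℂ W) w) v d) ≃ₗ[ℤ]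
      Abelianized n v}
    (he' : ∀ d z, e' (DirectSum.lof ℤ ℕ _ d z) =
      grClass v d (z : W × V).2 (h.snd_mem_pbwFilt z.2))
    (α : PosRoot n) (m d : ℕ) (z : Pairs n W V κ κ' ℓ i ((g : Module.End ℂ W) w) v d) :
    e' (e.symm (SymZ.gen α m • e (DirectSum.lof ℤ ℕ _ d z))) =
      chevalleyTwist n (SymZ.gen α m) • e' (DirectSum.lof ℤ ℕ _ d z) := by
  rcases eq_or_ne m 0 with rfl | hm
  · rw [SymZ.gen_zero, map_one, one_smul, one_smul, e.symm_apply_apply]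
  rw [he', chevalleyTwist_gen_smul_grClass]
  have hlt : (α.1.1 : ℕ) < α.1.2 := α.2
  have hin : (α.1.1 : ℕ) < n ∧ (α.1.2 : ℕ) < n := ⟨α.1.1.2, α.1.2.2⟩
  -- Precisely for these roots `E_{φ(α)}` is a lowering operator of the block, and then both sides
  -- come from the same operator on pairs, the sign of `θ` undoing that of the twist. For all other
  -- roots both sides vanish.
  by_cases hα : (α.1.1 : ℕ) < i ∧ i ≤ (α.1.2 : ℕ)
  · have h1 : α.1.1 ∈ initialSet n i := by rw [mem_initialSet]; exact hα.1
    have h2 : α.1.2 ∉ initialSet n i := by rw [mem_initialSet]; omega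
    let z' : Pairs n W V κ κ' ℓ i ((g : Module.End ℂ W) w) v (d + m) :=
      ⟨divPow (pairUnit (n := n) W V κ κ' ℓ i α.1.2 α.1.1) m z, lower_mem_lattice h1 h2 m z.2⟩
    have hfst : (z' : W × V).1 =
        divPow (blockUnit (n := n) W κ i α.1.2 α.1.1) m (z : W × V).1 :=
      map_divPow_apply (u := LinearMap.fst ℂ W V)
        (f := pairUnit (n := n) W V κ κ' ℓ i α.1.2 α.1.1) (fun _ => rfl) m _
    have hsnd : (z' : W × V).2 =
        divPow (twistedUnit (n := n) V κ' ℓ α.1.2 α.1.1) m (z : W × V).2 :=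
      map_divPow_apply (u := LinearMap.snd ℂ W V)
        (f := pairUnit (n := n) W V κ κ' ℓ i α.1.2 α.1.1) (fun _ => rfl) m _
    have hleft : SymZ.gen α m • e (DirectSum.lof ℤ ℕ _ d z) =
        e (DirectSum.lof ℤ ℕ _ (d + m) z') := by
      apply Subtype.ext
      rw [gen_smul_demazure, he, he, hfst, uAct_divPow_abelVec κ, blockUnit]
      congr 3
      · ext
        rw [blockIndex_val, if_neg (by omega)]
      · ext
        rw [blockIndex_val, if_pos hα.1]
    rw [hleft, e.symm_apply_apply, he', zsmul_grClass]
    refine grClass_congr rfl _ _ ?_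
    rw [uAct_divPow_lowVec_dualRoot κ' ℓ, LinearMap.smul_apply, smul_smul, ← mul_pow,
      neg_one_mul, neg_neg, one_pow, one_smul, hsnd, sub_self]
    exact zero_mem _
  · have hleft : SymZ.gen α m • e (DirectSum.lof ℤ ℕ _ d z) = 0 := by
      apply Subtype.ext
      rw [gen_smul_demazure, he, uAct_divPow_abelVec κ]
      refine divPow_succ_apply_eq_zero (h.extremal.kill_outside h.lt ?_ ?_
        (mem_level_of_mem_lattice (fst_mem z.2))) hm
      · simp [Fin.ext_iff]
        omega
      · simp only
        omega
    have hright : grClass v (d + m) (uAct V (divPow (lowVec (dualRoot α)) m) (z : W × V).2)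
        (low_mem v (dualRoot α) m d (h.snd_mem_pbwFilt z.2)) = 0 := by
      refine grClass_eq_zero _ ?_
      rw [pbwFilt_eq_latticeLE h.extremal']
      -- The Levi operator keeps the lattice degree `d`, and `d ≤ d + m - 1` since `m ≠ 0`; hence
      -- the class in degree `d + m` is zero.
      refine lattice_le_latticeLE (e := d) (by push_cast; omega)
        (uAct_levi_mem_lattice h.extremal' ?_ m (snd_mem z.2))
      simp only [dualRoot, Fin.rev_rev, mem_initialSet]
      omega
    rw [hleft, hright, map_zero, map_zero, smul_zero]

theorem nonempty_equiv {w : W} {g : (Module.End ℂ W)ˣ}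
    (h : IsMatchedPair (n := n) κ κ' ℓ i ((g : Module.End ℂ W) w) v) :
    Nonempty (demazure (2 * n) g w ≃ₛₗ[chevalleyTwist n] Abelianized n v) := by
  obtain ⟨e, he⟩ := h.exists_equiv_demazure
  obtain ⟨e', he'⟩ := h.exists_equiv_abelianized
  let E : demazure (2 * n) g w ≃ₗ[ℤ] Abelianized n v := e.symm.trans e'
  have hgen : ∀ α m y, E (SymZ.gen α m • y) = chevalleyTwist n (SymZ.gen α m) • E y := by
    intro α m y
    obtain ⟨y, rfl⟩ := e.surjective y
    change e' (e.symm _) = _ • e' (e.symm (e y))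
    rw [e.symm_apply_apply]
    induction y using DirectSum.induction_on with
    | zero => simp
    | of d z => exact h.equiv_gen_smul he he' α m d z
    | add y y' hy hy' => rw [map_add, smul_add, map_add, map_add, hy, hy', map_add, smul_add]
  -- Both actions are transported to ring homomorphisms from `SymZ n` into the same endomorphism
  -- ring, so that agreement on the generators suffices.
  have hhom : ((E.conjRingEquiv : _ →+* _).comp (demazureAct g w)) =
      (abelAct v).comp (chevalleyTwist n) := by
    refine SymZ.hom_ext fun α m => LinearMap.ext fun y => ?_
    obtain ⟨y, rfl⟩ := E.surjective y
    change E (demazureAct g w (SymZ.gen α m) (E.symm (E y))) = _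
    rw [E.symm_apply_apply]
    exact hgen α m y
  refine ⟨{ E.toAddEquiv with
    map_smul' := fun s y => ?_ }⟩
  have := DFunLike.congr_fun (DFunLike.congr_fun hhom s) (E y)
  change E (demazureAct g w s (E.symm (E y))) = _ at this
  rw [E.symm_apply_apply] at this
  exact this

end IsMatchedPair

theorem IsHighestWeightVector.isMatchedPair {i : Set.Ioo 0 n} {ℓ : ℕ}
    [FiniteDimensional ℂ W] [LieModule.IsIrreducible ℂ (SlN (2 * n)) W]
    [FiniteDimensional ℂ V] [LieModule.IsIrreducible ℂ (SlN n) V]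
    {w : W} (hw : IsHighestWeightVector (Psi (Pi.single i (ℓ : ℤ))) w)
    {g : (Module.End ℂ W)ˣ} (hg : IsWeylRepresentative (tau n) g)
    {v : V} (hv : IsHighestWeightVector (Pi.single (dualIndex i) (ℓ : ℤ)) v) :
    IsMatchedPair (n := n) (((ℓ : ℤ) : ℂ) * ((2 * (i : ℕ) : ℕ) : ℂ) / ((2 * n : ℕ) : ℂ))
      (((ℓ : ℤ) : ℂ) * ((n - (i : ℕ) : ℕ) : ℂ) / (n : ℂ)) ℓ i ((g : Module.End ℂ W) w) v := by
  rw [Psi_single] at hw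
  refine ⟨i.2.2, hw.isExtremal.map_perm (isGlRep_matUnit _) (isSimpleFamily_matUnit _)
    (hg.apply_matUnit _), isSimpleFamily_matUnit _, hv.isExtremal.dualUnit Fin.revPerm fun a => ?_,
    (isSimpleFamily_matUnit _).dualUnit _ _⟩
  have h1 := i.2.1
  have h2 := i.2.2
  have h3 := a.2
  rw [mem_initialSet, mem_initialSet, Fin.revPerm_apply, Fin.val_rev]
  change _ ↔ ¬n - (a + 1) < n - i
  omega

end Isomorphism

end AbelianizedDemazure

end

theorem mainTheorem9 (n : ℕ) (i : Set.Ioo 0 n) (ℓ : ℕ)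
    {W : Type*} [AddCommGroup W] [Module ℂ W] [LieRingModule (SlN (2 * n)) W]
    [LieModule ℂ (SlN (2 * n)) W] [FiniteDimensional ℂ W] [LieModule.IsIrreducible ℂ (SlN (2 * n)) W]
    (w : W) (hw : IsHighestWeightVector (Psi (Pi.single i (ℓ : ℤ))) w)
    (g : (Module.End ℂ W)ˣ) (hg : IsWeylRepresentative (tau n) g)
    {V : Type*} [AddCommGroup V] [Module ℂ V] [LieRingModule (SlN n) V]
    [LieModule ℂ (SlN n) V] [FiniteDimensional ℂ V] [LieModule.IsIrreducible ℂ (SlN n) V]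
    (v : V) (hv : IsHighestWeightVector (Pi.single (dualIndex i) (ℓ : ℤ)) v) :
    Nonempty (demazure (2 * n) g w ≃ₛₗ[chevalleyTwist n] Abelianized n v) := by
  have hi := i.2.1
  have hi' := i.2.2
  have : NeZero n := ⟨by omega⟩
  have : NeZero (2 * n) := ⟨by omega⟩
  exact (hw.isMatchedPair hg hv).nonempty_equiv
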